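/- **Notation.** Let $F_2=\langle u,v\rangle$ be the free group on two generators $t_1=u$, $t_2=v$; write $[x,y]=x^{-1}y^{-1}xy$, $\varphi_x\colon y\mapsto xyx^{-1}$, and $\mathrm{Int}(F_2)=\{\varphi_x : x\in F_2\}$. The product in $\mathrm{Aut}(F_2)$ is composition of maps. Let $B_3=\langle a,b\mid aba=bab\rangle$, $s=aba$, and let $DB_3=B_3\rtimes\Delta$ (dihedral braid group), where $\Delta=\{1,d\}$ has two elements and $d$ acts on $B_3$ by $a\mapsto b^{-1}$, $b\mapsto a^{-1}$. Let $\Phi\colon DB_3\to \mathrm{Aut}(F_2)$ be the morphism $\Phi(a)=\alpha$, $\Phi(b)=\beta$, $\Phi(d)=\delta$ with $\alpha(u,v)=(u,u^{-1}v)$, $\beta(u,v)=(vu,v)$, $\delta(u,v)=(v,u)$. Let $\rho\colon \mathrm{Aut}(F_2)\to GL(2,\mathbb Z)$ be induced by the abelianization $F_2\to\mathbb Z^2$. If $K,L,M$ are groups, $\psi\colon L\to\mathrm{Aut}(K)$ is a morphism, and $\kappa\colon M\to K$, $\lambda\colon M\to L$ are injective morphisms with $\lambda(M)$ normal in $L$,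 $\psi(l)(\kappa(m))=\kappa(\lambda^{-1}(l\lambda(m)l^{-1}))$ and $\psi(\lambda(m))(k)=\kappa(m)k\kappa(m)^{-1}$, then $\mu(m)=(\kappa(m)^{-1},\lambda(m))$ embeds $M$ as a normal subgroup of $K\rtimes_\psi L$, and the semidirect product of $K$ and $L$ amalgamated over $M$ is $K\rtimes_{\psi,M}L=(K\rtimes_\psi L)/\mu(M)$. **Theorem.** (i) Every surjective endomorphism of $F_2$ is an automorphism. (ii) One has $\varphi_{[u,v]}=\Phi(s^4)$. Let $\Phi(DB_3)$ act on $\mathrm{Int}(F_2)$ by conjugation in $\mathrm{Aut}(F_2)$, and let $Y=\langle\varphi_{[u,v]}\rangle=\langle\Phi(s^4)\rangle$, a common subgroup of $\mathrm{Int}(F_2)$ and $\Phi(DB_3)$. Then $(k,l)\mapsto kl$ induces an isomorphism from the amalgamated semidirect product $\mathrm{Int}(F_2)\rtimes_{Y}\Phi(DB_3)$ onto $\mathrm{Aut}(F_2)$: $$\mathrm{Aut}(F_2)=\mathrm{Int}(F_2)\rtimes_{\langle\varphi_{[u,v]}=\Phi(s^4)\rangle}\Phi(DB_3).$$ (iii)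 $\mathrm{Int}(F_2)=\ker\bigl(\rho\colon \mathrm{Aut}(F_2)\to GL(2,\mathbb Z)\bigr)$. (iv) Let $\varphi\colon F_2\to F_2$ be an endomorphism and $X_i=\varphi(t_i)$, $i=1,2$. Then $\varphi$ is an automorphism if and only if there are $w\in F_2$ and a sign $\pm$ with $[X_1,X_2]=w^{-1}[t_1,t_2]^{\pm1}w$. Moreover $\varphi$ lies in $\Phi(DB_3)$ if and only if $[X_1,X_2]=[t_1,t_2]$ or $[X_1,X_2]=[t_1,t_2]^{-1}$. -/

import Mathlib

namespace NielsenF2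

/-! Amalgamated semidirect products. -/

/-- The data needed to amalgamate a semidirect product `K ⋊[ψ] L` over a common subgroup `M`,
embedded in `K` by `κ` and in `L` by `lam`: the image of `M` is normal in `L`, the action `ψ`
of `L` on the image of `M` in `K` is conjugation in `L`, and `M` acts on `K` by
conjugation in `K`. -/
structure AmalgamationDatum (K L M : Type*) [Group K] [Group L] [Group M] where
  ψ : L →* MulAut K
  κ : M →* K
  lam : M →* L
  κ_injective : Function.Injective κ
  lam_injective : Function.Injective lam
  lam_normal : lam.range.Normal
  ψ_κ : ∀ (l : L) (m m' : M), lam m' = l * lam m * l⁻¹ → ψ l (κ m) = κ m'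
  ψ_lam : ∀ (m : M) (k : K), ψ (lam m) k = κ m * k * (κ m)⁻¹

namespace AmalgamationDatum

variable {K L M : Type*} [Group K] [Group L] [Group M]

/-- The morphism `μ : M → K ⋊ L`, `m ↦ (κ(m)⁻¹, lam(m))`. -/
def μ (D : AmalgamationDatum K L M) : M →* K ⋊[D.ψ] L where
  toFun m := ⟨(D.κ m)⁻¹, D.lam m⟩
  map_one' := by ext <;> simp
  map_mul' m m' := by
    ext
    · simp [D.ψ_lam, mul_assoc]
    · simp

theorem μ_range_normal (D : AmalgamationDatum K L M) : D.μ.range.Normal := by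
  constructor
  rintro _ ⟨m, rfl⟩ g
  obtain ⟨m', hm'⟩ := D.lam_normal.conj_mem (D.lam m) ⟨m, rfl⟩ g.right
  refine ⟨m', ?_⟩
  have h1 := D.ψ_κ g.right m m' hm'
  have h2 : D.ψ (g.right * D.lam m) (D.ψ g.right⁻¹ g.left⁻¹)
      = D.κ m' * g.left⁻¹ * (D.κ m')⁻¹ := by
    rw [← MulAut.mul_apply, ← map_mul, ← hm', D.ψ_lam]
  have h2' := congrArg Inv.inv h2
  ext
  · simp only [map_mul, map_inv, MulAut.mul_apply] at h2
    simp only [μ, MonoidHom.coe_mk, OneHom.coe_mk, SemidirectProduct.mul_left,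
      SemidirectProduct.mul_right, SemidirectProduct.inv_left,
      map_mul, map_inv, MulAut.mul_apply, h1, h2]
    group
  · simpa [μ] using hm'

instance (D : AmalgamationDatum K L M) : D.μ.range.Normal := D.μ_range_normal

/-- The semidirect product of `K` and `L` along `ψ`, amalgamated over `M`:
the quotient of `K ⋊[ψ] L` by the normal subgroup `μ(M)`. -/
abbrev Product (D : AmalgamationDatum K L M) : Type _ := (K ⋊[D.ψ] L) ⧸ D.μ.range

/-- The class of `(k, l)` in the amalgamated semidirect product. -/
def toProduct (D : AmalgamationDatum K L M) (k : K) (l : L) : D.Product :=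
  QuotientGroup.mk (⟨k, l⟩ : K ⋊[D.ψ] L)

/-- The amalgamation datum given by a normal subgroup `K` and a subgroup `L` of a group `G`, with
`L` acting on `K` by conjugation in `G`, and a subgroup `M` of both, normal in `L`. -/
def ofSubgroups {G : Type*} [Group G] (K L M : Subgroup G) [K.Normal] (hMK : M ≤ K) (hML : M ≤ L)
    (hM : ∀ l ∈ L, ∀ m ∈ M, l * m * l⁻¹ ∈ M) : AmalgamationDatum K L M where
  ψ := MulAut.conjNormal.comp L.subtype
  κ := Subgroup.inclusion hMK
  lam := Subgroup.inclusion hML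
  κ_injective := Subgroup.inclusion_injective hMK
  lam_injective := Subgroup.inclusion_injective hML
  lam_normal := by
    constructor
    rintro _ ⟨m, rfl⟩ g
    exact ⟨⟨g * m * (g : G)⁻¹, hM g g.2 m m.2⟩, rfl⟩
  ψ_κ l m m' h := by
    have h' := congrArg (Subtype.val) h
    apply Subtype.ext
    simpa using h'.symm
  ψ_lam m k := by
    apply Subtype.ext
    simp

end AmalgamationDatum

/-! The braid group `B₃` and the dihedral braid group `DB₃`. -/

/-- The relator `a b a (b a b)⁻¹`. -/
def braidRel : Set (FreeGroup (Fin 2)) :=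
  {FreeGroup.of 0 * FreeGroup.of 1 * FreeGroup.of 0 *
    (FreeGroup.of 1 * FreeGroup.of 0 * FreeGroup.of 1)⁻¹}

/-- The three strand braid group `⟨a, b | aba = bab⟩`. -/
abbrev B3 : Type := PresentedGroup braidRel

namespace B3

def a : B3 := PresentedGroup.of 0
def b : B3 := PresentedGroup.of 1
def s : B3 := a * b * a

theorem braid : a * b * a = b * a * b := by
  have h : PresentedGroup.mk braidRel (FreeGroup.of 0 * FreeGroup.of 1 * FreeGroup.of 0 *
    (FreeGroup.of 1 * FreeGroup.of 0 * FreeGroup.of 1)⁻¹) = 1 :=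
    PresentedGroup.one_of_mem rfl
  rw [map_mul, map_inv, mul_inv_eq_one] at h
  simp only [map_mul] at h
  exact h

/-- The morphism out of `B₃` given by two elements satisfying the braid relation. -/
def lift {G : Type*} [Group G] (x y : G) (h : x * y * x = y * x * y) : B3 →* G :=
  PresentedGroup.toGroup (f := ![x, y]) (by
    rintro r hr
    rw [Set.mem_singleton_iff.mp hr]
    simp only [map_mul, map_inv, FreeGroup.lift_apply_of, mul_inv_eq_one]
    exact h)

@[simp] theorem lift_a {G : Type*} [Group G] (x y : G) (h : x * y * x = y * x * y) :
    lift x y h a = x := by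
  simp [lift, a]

@[simp] theorem lift_b {G : Type*} [Group G] (x y : G) (h : x * y * x = y * x * y) :
    lift x y h b = y := by
  simp [lift, b]

theorem hom_ext {G : Type*} [Group G] {f g : B3 →* G} (ha : f a = g a) (hb : f b = g b) :
    f = g := by
  apply PresentedGroup.ext
  intro i
  fin_cases i
  · exact ha
  · exact hb

def flipHom : B3 →* B3 := lift b⁻¹ a⁻¹ (by
  have h := congrArg Inv.inv braid
  simpa [mul_assoc] using h.symm)

theorem flipHom_comp : flipHom.comp flipHom = MonoidHom.id B3 := by
  apply hom_ext <;> simp [flipHom]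

/-- The involution `a ↦ b⁻¹`, `b ↦ a⁻¹` of `B₃`. -/
def flip : MulAut B3 := flipHom.toMulEquiv flipHom flipHom_comp flipHom_comp

theorem flip_mul_self : flip * flip = 1 := by
  ext x
  exact DFunLike.congr_fun flipHom_comp x

end B3

/-- The group `Δ = {1, d}` with two elements. -/
abbrev Δ : Type := Multiplicative (ZMod 2)

/-- The morphism `Δ → G` sending `d` to a given `g` with `g² = 1`. -/
def Δ.lift {G : Type*} [Group G] (g : G) (hg : g * g = 1) : Δ →* G where
  toFun x := g ^ (Multiplicative.toAdd x).val
  map_one' := by simp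
  map_mul' x y := by
    have h2 : g ^ 2 = 1 := by rw [pow_two, hg]
    rw [toAdd_mul, ZMod.val_add, ← pow_add, ← pow_eq_pow_mod _ h2]

/-- The generator of `Δ`. -/
def Δ.d : Δ := Multiplicative.ofAdd 1

@[simp] theorem Δ.lift_d {G : Type*} [Group G] (g : G) (hg : g * g = 1) : Δ.lift g hg Δ.d = g := by
  change g ^ (1 : ZMod 2).val = g
  rw [ZMod.val_one, pow_one]

theorem Δ.eq_one_or_d (x : Δ) : x = 1 ∨ x = Δ.d := by
  change Multiplicative.toAdd x = 0 ∨ Multiplicative.toAdd x = 1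
  generalize Multiplicative.toAdd x = y
  revert y
  decide

theorem Δ.hom_ext {G : Type*} [Group G] {f g : Δ →* G} (h : f Δ.d = g Δ.d) : f = g := by
  apply MonoidHom.ext
  intro x
  rcases Δ.eq_one_or_d x with rfl | rfl
  · rw [map_one, map_one]
  · exact h

/-- The action of `Δ` on `B₃` with `a ^ d = b⁻¹`, `b ^ d = a⁻¹`. -/
def Δ.action : Δ →* MulAut B3 := Δ.lift B3.flip B3.flip_mul_self

/-- The group of three strand dihedral braids. -/
abbrev DB3 : Type := B3 ⋊[Δ.action] Δ

/-! The free group of rank two, its automorphisms, and the morphisms `Φ` and `ρ`. -/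

/-- The free group on `t₁ = u` and `t₂ = v`. -/
abbrev F2 : Type := FreeGroup (Fin 2)

def u : F2 := FreeGroup.of 0
def v : F2 := FreeGroup.of 1

/-- The commutator `[x, y] = x⁻¹ y⁻¹ x y` (not Mathlib's `⁅x, y⁆ = x y x⁻¹ y⁻¹`). -/
def comm {G : Type*} [Group G] (x y : G) : G := x⁻¹ * y⁻¹ * x * y

/-- The endomorphism of `F₂` with `u ↦ x`, `v ↦ y`. -/
def endo (x y : F2) : F2 →* F2 := FreeGroup.lift ![x, y]

@[simp] theorem endo_u (x y : F2) : endo x y u = x := by simp [endo, u]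
@[simp] theorem endo_v (x y : F2) : endo x y v = y := by simp [endo, v]

theorem F2.hom_ext {G : Type*} [Group G] {f g : F2 →* G} (hu : f u = g u) (hv : f v = g v) :
    f = g := by
  apply FreeGroup.ext_hom
  intro i
  fin_cases i
  · exact hu
  · exact hv

theorem F2.aut_ext {f g : MulAut F2} (hu : f u = g u) (hv : f v = g v) : f = g := by
  ext x
  exact DFunLike.congr_fun (F2.hom_ext (f := f.toMonoidHom) (g := g.toMonoidHom) hu hv) x

/-- `α(u, v) = (u, u⁻¹v)`. -/
def α : MulAut F2 := (endo u (u⁻¹ * v)).toMulEquiv (endo u (u * v))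
  (F2.hom_ext (by simp) (by simp)) (F2.hom_ext (by simp) (by simp))

/-- `β(u, v) = (vu, v)`. -/
def β : MulAut F2 := (endo (v * u) v).toMulEquiv (endo (v⁻¹ * u) v)
  (F2.hom_ext (by simp) (by simp)) (F2.hom_ext (by simp) (by simp))

/-- `δ(u, v) = (v, u)`. -/
def δ : MulAut F2 := (endo v u).toMulEquiv (endo v u)
  (F2.hom_ext (by simp) (by simp)) (F2.hom_ext (by simp) (by simp))

@[simp] theorem α_u : α u = u := endo_u u (u⁻¹ * v)
@[simp] theorem α_v : α v = u⁻¹ * v := endo_v u (u⁻¹ * v)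
@[simp] theorem β_u : β u = v * u := endo_u (v * u) v
@[simp] theorem β_v : β v = v := endo_v (v * u) v
@[simp] theorem δ_u : δ u = v := endo_u v u
@[simp] theorem δ_v : δ v = u := endo_v v u

theorem αβα : α * β * α = β * α * β :=
  F2.aut_ext (by simp [mul_assoc]) (by simp [mul_assoc])

theorem δδ : δ * δ = 1 := F2.aut_ext (by simp) (by simp)

theorem δαδ : δ * α * δ⁻¹ = β⁻¹ := by
  rw [mul_inv_eq_iff_eq_mul, eq_inv_mul_iff_mul_eq]
  exact F2.aut_ext (by simp) (by simp)

theorem δβδ : δ * β * δ⁻¹ = α⁻¹ := by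
  rw [mul_inv_eq_iff_eq_mul, eq_inv_mul_iff_mul_eq]
  exact F2.aut_ext (by simp) (by simp)

/-- `Ψ(a) = α`, `Ψ(b) = β`. -/
def Ψ : B3 →* MulAut F2 := B3.lift α β αβα

theorem Ψ_flip : Ψ.comp B3.flip.toMonoidHom = (MulAut.conj δ).toMonoidHom.comp Ψ := by
  apply B3.hom_ext
  · change Ψ (B3.flipHom B3.a) = δ * Ψ B3.a * δ⁻¹
    simp [Ψ, B3.flipHom, δαδ]
  · change Ψ (B3.flipHom B3.b) = δ * Ψ B3.b * δ⁻¹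
    simp [Ψ, B3.flipHom, δβδ]

/-- `Φ(a) = α`, `Φ(b) = β`, `Φ(d) = δ`. -/
def Φ : DB3 →* MulAut F2 := SemidirectProduct.lift Ψ (Δ.lift δ δδ) (by
  intro x
  rcases Δ.eq_one_or_d x with rfl | rfl
  · ext; simp
  · simpa [Δ.action] using Ψ_flip)

theorem Φ_a : Φ (SemidirectProduct.inl B3.a) = α := by simp [Φ, Ψ]
theorem Φ_b : Φ (SemidirectProduct.inl B3.b) = β := by simp [Φ, Ψ]
theorem Φ_d : Φ (SemidirectProduct.inr Δ.d) = δ := by simp [Φ]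

/-- The inner automorphism `φ_x : y ↦ x y x⁻¹`. -/
def inner (x : F2) : MulAut F2 := MulAut.conj x

/-- The group of inner automorphisms of `F₂`. -/
def Int : Subgroup (MulAut F2) := (MulAut.conj : F2 →* MulAut F2).range

instance : Int.Normal := by
  constructor
  rintro _ ⟨x, rfl⟩ g
  refine ⟨g x, ?_⟩
  ext y
  simp

/-- The element `s⁴` of `B₃ ⊆ DB₃`, where `s = aba = bab`. -/
def s4 : DB3 := SemidirectProduct.inl (B3.s ^ 4)

theorem inner_eq_Φ_s4 : inner (comm u v) = Φ s4 := by
  have h : Φ s4 = (α * β * α) ^ 4 := by simp [s4, B3.s, Φ, Ψ]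
  rw [h]
  apply F2.aut_ext <;> simp [inner, comm, pow_succ, mul_assoc]

/-- The cyclic group generated by `φ_{[u,v]} = Φ(s⁴)`. -/
def Y : Subgroup (MulAut F2) := Subgroup.zpowers (inner (comm u v))

theorem Y_le_Int : Y ≤ Int := by
  rw [Y, Subgroup.zpowers_le]
  exact ⟨_, rfl⟩

theorem Y_le_Φ : Y ≤ Φ.range := by
  rw [Y, Subgroup.zpowers_le, inner_eq_Φ_s4]
  exact ⟨_, rfl⟩

theorem conj_inner (g : MulAut F2) (x : F2) : g * inner x * g⁻¹ = inner (g x) := by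
  ext y
  simp [inner]

theorem Ψ_conj_inner (x : B3) : Ψ x * inner (comm u v) * (Ψ x)⁻¹ = inner (comm u v) := by
  have h : (MulAut.conj (inner (comm u v))).toMonoidHom.comp Ψ = Ψ := by
    apply B3.hom_ext
    · change inner (comm u v) * Ψ B3.a * (inner (comm u v))⁻¹ = Ψ B3.a
      rw [mul_inv_eq_iff_eq_mul, eq_comm, ← mul_inv_eq_iff_eq_mul, conj_inner]
      simp [Ψ, comm, mul_assoc]
    · change inner (comm u v) * Ψ B3.b * (inner (comm u v))⁻¹ = Ψ B3.b
      rw [mul_inv_eq_iff_eq_mul, eq_comm, ← mul_inv_eq_iff_eq_mul, conj_inner]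
      simp [Ψ, comm, mul_assoc]
  have hx : inner (comm u v) * Ψ x * (inner (comm u v))⁻¹ = Ψ x := DFunLike.congr_fun h x
  rw [mul_inv_eq_iff_eq_mul] at hx ⊢
  exact hx.symm

theorem Y_normal : ∀ l ∈ Φ.range, ∀ m ∈ Y, l * m * l⁻¹ ∈ Y := by
  rintro _ ⟨⟨x, e⟩, rfl⟩ _ ⟨n, rfl⟩
  have hx : Φ ⟨x, e⟩ = Ψ x * Δ.lift δ δδ e := rfl
  have key : Φ ⟨x, e⟩ * inner (comm u v) * (Φ ⟨x, e⟩)⁻¹ ∈ Y := by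
    rw [hx]
    rcases Δ.eq_one_or_d e with rfl | rfl
    · rw [map_one, mul_one, Ψ_conj_inner]
      exact Subgroup.mem_zpowers _
    · have hδ : δ * inner (comm u v) * δ⁻¹ = (inner (comm u v))⁻¹ := by
        rw [conj_inner]
        simp [inner, comm, mul_assoc]
      have h2 : Ψ x * δ * inner (comm u v) * (Ψ x * δ)⁻¹ =
          Ψ x * (δ * inner (comm u v) * δ⁻¹) * (Ψ x)⁻¹ := by group
      rw [Δ.lift_d, h2, hδ, ← conj_inv, Ψ_conj_inner]
      exact Y.inv_mem (Subgroup.mem_zpowers _)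
  have := Y.zpow_mem key n
  rwa [conj_zpow] at this

/-- The datum for amalgamating `Int(F₂)` and `Φ(DB₃)`, acting on it by conjugation in `Aut(F₂)`,
over the common subgroup generated by `φ_{[u,v]} = Φ(s⁴)`. -/
def nielsenDatum : AmalgamationDatum Int Φ.range Y :=
  AmalgamationDatum.ofSubgroups Int Φ.range Y Y_le_Int Y_le_Φ Y_normal

/-- The abelianization morphism `F₂ → ℤ²`, sending `u`, `v` to the canonical basis. -/
def ab : F2 →* Multiplicative (Fin 2 → ℤ) :=
  FreeGroup.lift fun i => Multiplicative.ofAdd (Pi.single i 1)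

/-- The matrix of the endomorphism of `ℤ²` induced by an endomorphism `f` of `F₂`: its columns
are the abelianizations of `f(u)` and `f(v)`. -/
def abMatrix (f : F2 →* F2) : Matrix (Fin 2) (Fin 2) ℤ :=
  Matrix.of fun i j => (ab (f (FreeGroup.of j))).toAdd i

/-- `abMatrix f` does induce `f` on abelianizations. -/
theorem abMatrix_mulVec (f : F2 →* F2) (x : F2) :
    (abMatrix f).mulVec (ab x).toAdd = (ab (f x)).toAdd := by
  have h : (AddMonoidHom.toMultiplicative (abMatrix f).mulVecLin.toAddMonoidHom).comp ab =
      ab.comp f := by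
    apply FreeGroup.ext_hom
    intro j
    apply Multiplicative.toAdd.injective
    ext i
    simp [ab, abMatrix]
  exact congrArg Multiplicative.toAdd (DFunLike.congr_fun h x)

/-- The morphism `ρ : Aut(F₂) → GL(2, ℤ)` induced by abelianization. -/
def ρ : MulAut F2 →* GL (Fin 2) ℤ :=
  MonoidHom.toHomUnits
    { toFun := fun f => abMatrix f.toMonoidHom
      map_one' := by
        ext i j
        simp [abMatrix, ab, Matrix.one_apply, Pi.single_apply]
      map_mul' := fun f g => by
        ext i j
        have h := congrFun (abMatrix_mulVec f.toMonoidHom (g (FreeGroup.of j))) i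
        exact h.symm }

end NielsenF2

/-! The core is Nielsen reduction, with cancellation measured by the common prefix length `cp`,
which satisfies an ultrametric inequality. Starting from (f(u), f(v)), apply the Nielsen moves
coming from N = Int(F₂)·Φ(DB₃), together with simultaneous conjugations, and choose a pair (x, y) of
least total length. Minimality bounds all common prefixes (`IsMinPair.cp_bounds`), so in a reduced
word in x, y no factor is ever entirely cancelled (`IsMinPair.isSpread`). Hence lengths cannot drop
(`IsSpread.norm_le`), and the powers of the commutator of x and y grow at a known linear rate
(`IsSpread.norm_commutator_mul`). If f is surjective, or if it sends [u,v] to a conjugate of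
[u,v]^±1, then x and y must have length one, so f lies in N. This is `exists_mem_nielsenSubgroup`,
which gives (i), the generation of Aut(F₂), and the first half of (iv).

For (iii), every element of Out(F₂) is a positive word in α⁻¹ and δ up to diagonal elements
(`IsGL2System.normalForm`). Positive words have nonnegative matrices whose entry sum detects 1 and
δ, so ρ is injective on Out(F₂).

For the amalgamation in (ii) and the second half of (iv), Φ(DB₃) preserves [u,v] up to inversion.
The Heisenberg quotient shows that [u,v] is neither a proper power nor conjugate to its inverse, so
its centralizer is cyclic, generated by [u,v]. Therefore Int(F₂) ∩ Φ(DB₃) is contained in Y. -/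

namespace FreeGroup

/-! The common prefix length of reduced words, and the resulting tree metric on a free group. -/

/-- The length of the longest common prefix of two lists. -/
def lcpLength {B : Type*} [DecidableEq B] : List B → List B → ℕ
  | a :: l, b :: m => if a = b then lcpLength l m + 1 else 0
  | [], _ => 0
  | _ :: _, [] => 0

section lists

variable {B : Type*} [DecidableEq B]

theorem lcpLength_comm (l m : List B) : lcpLength l m = lcpLength m l := by
  induction l generalizing m with
  | nil => cases m <;> simp [lcpLength]
  | cons a l ih => cases m with
    | nil => simp [lcpLength]
    | cons b m => simp [lcpLength, ih m, eq_comm]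

theorem lcpLength_le_left (l m : List B) : lcpLength l m ≤ l.length := by
  induction l generalizing m with
  | nil => simp [lcpLength]
  | cons a l ih => cases m with
    | nil => simp [lcpLength]
    | cons b m =>
      have := ih m
      simp only [lcpLength, List.length_cons]
      split <;> omega

/-- This is the ultrametric (0-hyperbolic) inequality of the tree. With the length formulas below it
reduces the cancellation arguments to linear arithmetic. -/
theorem min_lcpLength_le (l m n : List B) :
    min (lcpLength l m) (lcpLength m n) ≤ lcpLength l n := by
  induction l generalizing m n with
  | nil => simp [lcpLength]
  | cons a l ih => cases m with
    | nil => simp [lcpLength]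
    | cons b m => cases n with
      | nil => simp [lcpLength]
      | cons c n =>
        have := ih m n
        simp only [lcpLength]
        split_ifs <;> first | omega | simp_all

theorem lcpLength_take_left (n : ℕ) (l : List B) (h : n ≤ l.length) :
    lcpLength (l.take n) l = n := by
  induction l generalizing n with
  | nil => simp at h; simp [lcpLength, h]
  | cons a l ih => cases n with
    | zero => simp [lcpLength]
    | succ n => simp [lcpLength, ih n (by simpa using h)]

end lists

variable {A : Type*} [DecidableEq A]

theorem norm_mk_of_isReduced {l : List (A × Bool)} (h : IsReduced l) : (mk l).norm = l.length := by
  rw [norm, toWord_mk, h.reduce_eq]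

/-- Equal first letters cancel and are stripped by induction. Once the first letters differ, the
concatenation is already reduced. -/
theorem norm_inv_mul_mk {l m : List (A × Bool)} (hl : IsReduced l) (hm : IsReduced m) :
    ((mk l)⁻¹ * mk m).norm + 2 * lcpLength l m = l.length + m.length := by
  induction l generalizing m with
  | nil =>
    rw [← one_eq_mk, inv_one, one_mul, norm_mk_of_isReduced hm]
    simp [lcpLength]
  | cons a l ih => cases m with
    | nil =>
      rw [← one_eq_mk, mul_one, norm_inv_eq, norm_mk_of_isReduced hl]
      simp [lcpLength]
    | cons b m =>
      by_cases hab : a = b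
      · subst hab
        have h1 : (mk (a :: l))⁻¹ * mk (a :: m) = (mk l)⁻¹ * mk m := by
          rw [← List.singleton_append, ← List.singleton_append (l := m), ← mul_mk, ← mul_mk]
          group
        have := ih (m := m) (List.IsChain.tail hl) (List.IsChain.tail hm)
        rw [h1]
        simp only [lcpLength, if_true, List.length_cons]
        omega
      · have h1 : IsReduced (invRev (a :: l) ++ b :: m) := by
          refine List.IsChain.append ?_ hm ?_
          · have := isReduced_toWord (x := (mk (a :: l))⁻¹)
            rwa [toWord_inv, toWord_mk, hl.reduce_eq] at this
          · intro x hx y hy h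
            simp [invRev] at hx hy
            subst hx hy
            rcases a with ⟨a1, a2⟩
            rcases b with ⟨b1, b2⟩
            simp at h hab ⊢
            cases a2 <;> cases b2 <;> simp_all
        rw [inv_mk, mul_mk, norm_mk_of_isReduced h1]
        simp [lcpLength, hab, invRev_length]

/-- The length of the longest common prefix of the reduced words of `x` and `y`, that is, the
Gromov product of `x` and `y` at `1`. -/
def cp (x y : FreeGroup A) : ℕ := lcpLength x.toWord y.toWord

theorem cp_comm (x y : FreeGroup A) : cp x y = cp y x := lcpLength_comm _ _

theorem cp_le_left (x y : FreeGroup A) : cp x y ≤ x.norm := lcpLength_le_left _ _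

theorem min_cp_le (x y z : FreeGroup A) : min (cp x y) (cp y z) ≤ cp x z := min_lcpLength_le _ _ _

theorem norm_inv_mul (x y : FreeGroup A) : (x⁻¹ * y).norm + 2 * cp x y = x.norm + y.norm := by
  have := norm_inv_mul_mk (isReduced_toWord (x := x)) (isReduced_toWord (x := y))
  rwa [mk_toWord, mk_toWord] at this

theorem norm_mul (x y : FreeGroup A) : (x * y).norm + 2 * cp x⁻¹ y = x.norm + y.norm := by
  have := norm_inv_mul x⁻¹ y
  rwa [inv_inv, norm_inv_eq] at this

theorem cp_self (x : FreeGroup A) : cp x x = x.norm := by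
  have := norm_inv_mul x x
  rw [inv_mul_cancel, norm_one] at this
  omega

theorem exists_prefix (x : FreeGroup A) {n : ℕ} (h : n ≤ x.norm) :
    ∃ p : FreeGroup A, p.norm = n ∧ cp p x = n := by
  have hr : IsReduced (x.toWord.take n) :=
    List.IsChain.take (isReduced_toWord (x := x)) n
  refine ⟨mk (x.toWord.take n), ?_, ?_⟩
  · rw [norm_mk_of_isReduced hr, List.length_take]
    exact min_eq_left h
  · rw [cp, toWord_mk, hr.reduce_eq]
    exact lcpLength_take_left n _ h

theorem exists_common_prefix {x y : FreeGroup A} {n : ℕ} (h : n ≤ cp x y) :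
    ∃ p : FreeGroup A, p.norm = n ∧ cp p x = n ∧ cp p y = n := by
  obtain ⟨p, hp, hx⟩ := exists_prefix x (h.trans (cp_le_left x y))
  refine ⟨p, hp, hx, le_antisymm (hp ▸ cp_le_left p y) ?_⟩
  have := min_cp_le p x y
  omega

/-- Write x = g c g⁻¹ with c cyclically reduced and nontrivial. Comparing the lengths 2|g| + |c| of
x and 2|g| + 2|c| of x² gives `cp x x⁻¹` = |g|. -/
theorem two_mul_cp_inv_lt {x : FreeGroup A} (hx : x ≠ 1) : 2 * cp x x⁻¹ < x.norm := by
  have h0 := reduceCyclically.reduce_flatten_replicate_succ (isReduced_toWord (x := x)) 0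
  have h1 := reduceCyclically.reduce_flatten_replicate_succ (isReduced_toWord (x := x)) 1
  rw [← toWord_pow] at h0 h1
  have h0' := congrArg List.length h0
  have h1' := congrArg List.length h1
  change (x ^ 1).norm = _ at h0'
  change (x ^ 2).norm = _ at h1'
  simp [List.replicate_succ] at h0' h1'
  have hr : reduceCyclically x.toWord ≠ [] := by
    intro h
    simp [h] at h0
    have h2 := mk_toWord (x := x)
    rw [h0, ← mul_mk, ← inv_mk, mul_inv_cancel] at h2
    exact hx h2.symm
  have := List.length_pos_of_ne_nil hr
  have h3 := norm_mul x x
  rw [← pow_two, cp_comm] at h3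
  omega

end FreeGroup

/-! ### Pairs of minimal length under Nielsen moves and conjugation. -/

namespace FreeGroup

variable {A : Type*}

/-- The image of a letter. -/
abbrev letterMap {B : Type*} (f : FreeGroup B →* FreeGroup A) (l : B × Bool) : FreeGroup A :=
  f (mk [l])

theorem letterMap_not {B : Type*} (f : FreeGroup B →* FreeGroup A) (l : B × Bool) :
    letterMap f (l.1, !l.2) = (letterMap f l)⁻¹ := by
  rw [letterMap, ← _root_.map_inv, inv_mk]
  simp [invRev]

theorem letterMap_cases (f : FreeGroup (Fin 2) →* FreeGroup A) :
    letterMap f (0, true) = f (of 0) ∧ letterMap f (0, false) = (f (of 0))⁻¹ ∧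
    letterMap f (1, true) = f (of 1) ∧ letterMap f (1, false) = (f (of 1))⁻¹ :=
  ⟨rfl, letterMap_not f (0, true), rfl, letterMap_not f (1, true)⟩

variable [DecidableEq A]

/-- What remains after stripping a prefix p is a suffix of x, so its inverse is a prefix of x⁻¹. -/
theorem cp_inv_mul_inv {p x : FreeGroup A} (h : cp p x = p.norm) :
    cp (p⁻¹ * x)⁻¹ x⁻¹ + p.norm = x.norm := by
  have h1 := norm_inv_mul p x
  have h2 := norm_inv_mul (p⁻¹ * x)⁻¹ x⁻¹
  have h3 : (p⁻¹ * x)⁻¹⁻¹ * x⁻¹ = p⁻¹ := by group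
  rw [h3, norm_inv_eq, norm_inv_eq, norm_inv_eq] at h2
  omega

/-- A set of pairs closed under simultaneous conjugation and under Nielsen moves. -/
structure IsNielsenClosed (R : Set (FreeGroup A × FreeGroup A)) : Prop where
  conj : ∀ p x y, (x, y) ∈ R → (p⁻¹ * x * p, p⁻¹ * y * p) ∈ R
  swap : ∀ x y, (x, y) ∈ R → (y, x) ∈ R
  inv : ∀ x y, (x, y) ∈ R → (x⁻¹, y) ∈ R
  mul_inv : ∀ x y, (x, y) ∈ R → (x, y * x⁻¹) ∈ R

/-- A pair of minimal total length in `R`. -/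
def IsMinPair (R : Set (FreeGroup A × FreeGroup A)) (x y : FreeGroup A) : Prop :=
  (x, y) ∈ R ∧ ∀ x' y', (x', y') ∈ R → x.norm + y.norm ≤ x'.norm + y'.norm

namespace IsMinPair

variable {R : Set (FreeGroup A × FreeGroup A)} {x y : FreeGroup A}

theorem swap (h : IsMinPair R x y) (hR : IsNielsenClosed R) : IsMinPair R y x :=
  ⟨hR.swap _ _ h.1, fun x' y' h' => add_comm x.norm y.norm ▸ h.2 x' y' h'⟩

theorem inv_left (h : IsMinPair R x y) (hR : IsNielsenClosed R) : IsMinPair R x⁻¹ y :=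
  ⟨hR.inv _ _ h.1, fun x' y' h' => (norm_inv_eq (x := x)).symm ▸ h.2 x' y' h'⟩

theorem inv_right (h : IsMinPair R x y) (hR : IsNielsenClosed R) : IsMinPair R x y⁻¹ :=
  ((h.swap hR).inv_left hR).swap hR

/-- The common prefix and the common suffix of a minimal pair make up at most half of it. -/
theorem two_mul_cp_add_le (h : IsMinPair R x y) (hR : IsNielsenClosed R) (hx : x ≠ 1)
    (hy : y ≠ 1) : 2 * (cp x y + cp x⁻¹ y⁻¹) ≤ x.norm := by
  obtain ⟨p, hp, hpx, hpy⟩ := exists_common_prefix (le_refl (cp x y))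
  have hx0 : x.norm ≠ 0 := fun h => hx (norm_eq_zero.mp h)
  have hy0 : y.norm ≠ 0 := fun h => hy (norm_eq_zero.mp h)
  have hξ := cp_inv_mul_inv (hpx.trans hp.symm)
  have hη := cp_inv_mul_inv (hpy.trans hp.symm)
  have hξ' := norm_inv_mul p x
  have hη' := norm_inv_mul p y
  -- Write x = pξ and y = pη. Conjugating by p turns (x, yx⁻¹) into (ξp, ηξ⁻¹), where |ξp| ≤ |x| and
  -- the prefix p has disappeared from the second entry. The same is done with x and y exchanged.
  have m1 := h.2 _ _ (hR.conj p _ _ (hR.mul_inv _ _ h.1))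
  have m2 := h.2 _ _ (hR.conj p _ _ (hR.mul_inv _ _ (hR.swap _ _ h.1)))
  rw [show p⁻¹ * (y * x⁻¹) * p = (p⁻¹ * y) * (p⁻¹ * x)⁻¹ by group] at m1
  rw [show p⁻¹ * (x * y⁻¹) * p = ((p⁻¹ * y) * (p⁻¹ * x)⁻¹)⁻¹ by group, norm_inv_eq] at m2
  have n1 := norm_mul_le (p⁻¹ * x) p
  have n2 := norm_mul_le (p⁻¹ * y) p
  have n3 := norm_mul (p⁻¹ * y) (p⁻¹ * x)⁻¹
  rw [norm_inv_eq] at n3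
  -- The common suffix of x and y survives in ξ and η unless it contains one of them whole. In that
  -- case `m1` and `m2` together would force x or y to be trivial.
  have u1 := min_cp_le (p⁻¹ * y)⁻¹ y⁻¹ x⁻¹
  have u2 := min_cp_le (p⁻¹ * y)⁻¹ x⁻¹ (p⁻¹ * x)⁻¹
  rw [cp_comm y⁻¹] at u1
  rw [cp_comm x⁻¹ (p⁻¹ * x)⁻¹] at u2
  omega

/-- No letter is the first one of `x`, `y` and `y⁻¹`. -/
theorem cp_eq_zero_or (h : IsMinPair R x y) (hR : IsNielsenClosed R) (hy : y ≠ 1) :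
    cp x y = 0 ∨ cp x y⁻¹ = 0 := by
  by_contra! hc
  obtain ⟨p, hp, hpx, hpy⟩ := exists_common_prefix (show 1 ≤ cp x y by omega)
  have hη := cp_inv_mul_inv (hpy.trans hp.symm)
  have hξ' := norm_inv_mul p x
  have hη' := norm_inv_mul p y
  -- Here y begins with the letter p and ends with p⁻¹, so conjugation by p shortens it by two
  -- without lengthening x. The bound `u4` guarantees |y| ≥ 3.
  have m := h.2 _ _ (hR.conj p _ _ h.1)
  have n1 := norm_mul_le (p⁻¹ * x) p
  have n2 := norm_mul (p⁻¹ * y) p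
  have u1 := min_cp_le p x y⁻¹
  have u2 := min_cp_le (p⁻¹ * y)⁻¹ y⁻¹ p
  have u3 := min_cp_le y x y⁻¹
  have u4 := two_mul_cp_inv_lt hy
  rw [cp_comm y⁻¹ p] at u2
  rw [cp_comm y x] at u3
  omega

/-- These follow by symmetry under exchange and inversion. By the vanishing alternatives, only `cp x
y` and `cp x⁻¹ y⁻¹`, or only the other two, can be nonzero. So all four add up to at most half of
the shorter element. -/
theorem cp_bounds (h : IsMinPair R x y) (hR : IsNielsenClosed R) (hx : x ≠ 1) (hy : y ≠ 1) :
    2 * (cp x y + cp x⁻¹ y⁻¹) ≤ x.norm ∧ 2 * (cp x y + cp x⁻¹ y⁻¹) ≤ y.norm ∧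
    2 * (cp x y⁻¹ + cp x⁻¹ y) ≤ x.norm ∧ 2 * (cp x y⁻¹ + cp x⁻¹ y) ≤ y.norm ∧
    (cp x y = 0 ∨ cp x y⁻¹ = 0) ∧ (cp x⁻¹ y = 0 ∨ cp x⁻¹ y⁻¹ = 0) ∧
    (cp x y = 0 ∨ cp x⁻¹ y = 0) ∧ (cp x y⁻¹ = 0 ∨ cp x⁻¹ y⁻¹ = 0) := by
  have p1 := h.two_mul_cp_add_le hR hx hy
  have p2 := (h.swap hR).two_mul_cp_add_le hR hy hx
  have p3 := (h.inv_right hR).two_mul_cp_add_le hR hx (inv_ne_one.mpr hy)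
  have p4 := ((h.inv_right hR).swap hR).two_mul_cp_add_le hR (inv_ne_one.mpr hy) hx
  have q1 := h.cp_eq_zero_or hR hy
  have q2 := (h.inv_left hR).cp_eq_zero_or hR hy
  have q3 := (h.swap hR).cp_eq_zero_or hR hx
  have q4 := ((h.inv_right hR).swap hR).cp_eq_zero_or hR hx
  simp only [inv_inv, norm_inv_eq] at p1 p2 p3 p4 q1 q2 q3 q4
  rw [cp_comm y⁻¹ x⁻¹, cp_comm y x] at p2
  rw [cp_comm y⁻¹ x, cp_comm y x⁻¹] at p4
  rw [cp_comm y x, cp_comm y x⁻¹] at q3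
  rw [cp_comm y⁻¹ x, cp_comm y⁻¹ x⁻¹] at q4
  exact ⟨p1, p2, p3, p4, q1, q2, q3, q4⟩

end IsMinPair

/-! ### Homomorphisms with controlled cancellation. -/

/-- The images of the letters are such that in a product of two successive cancellations never
eat up an entire factor. -/
def IsSpread {B : Type*} (f : FreeGroup B →* FreeGroup A) : Prop :=
  ∀ k l m : B × Bool, k ≠ l → m ≠ (l.1, !l.2) →
    cp (letterMap f k) (letterMap f l) + cp (letterMap f l)⁻¹ (letterMap f m) <
      (letterMap f l).norm

/-- `z` begins like a product whose first factor is the image of `l`. -/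
def BeginsWith {B : Type*} (f : FreeGroup B →* FreeGroup A) (l : B × Bool) (z : FreeGroup A) :
    Prop :=
  ∀ k ≠ l, cp (letterMap f k) (letterMap f l) < cp z (letterMap f l)

namespace IsSpread

variable {B : Type*} {f : FreeGroup B →* FreeGroup A}

theorem beginsWith (hf : IsSpread f) (l : B × Bool) : BeginsWith f l (letterMap f l) := by
  intro k hk
  have h1 := hf k l l hk (fun h => by simpa using congrArg Prod.snd h)
  rw [cp_self]
  omega

/-- Since z follows the image of m beyond the point where the inverse image of l leaves it, the
cancellation against z is exactly that against the image of m. Enough of the image of l is left to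
separate it from the other letters. -/
theorem cons (hf : IsSpread f) {l m : B × Bool} (hlm : m ≠ (l.1, !l.2)) {z : FreeGroup A}
    (hz : BeginsWith f m z) : BeginsWith f l (letterMap f l * z) ∧
      (letterMap f l * z).norm + 2 * cp (letterMap f l)⁻¹ (letterMap f m) =
        (letterMap f l).norm + z.norm := by
  have h1 := hz _ hlm.symm
  rw [letterMap_not] at h1
  have u1 := min_cp_le (letterMap f l)⁻¹ (letterMap f m) z
  have u2 := min_cp_le (letterMap f l)⁻¹ z (letterMap f m)
  rw [cp_comm _ z] at u1
  have n1 := norm_mul (letterMap f l) z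
  refine ⟨fun k hk => ?_, by omega⟩
  have h2 := hf k l m hk hlm
  have n2 := norm_inv_mul (letterMap f l * z) (letterMap f l)
  rw [show (letterMap f l * z)⁻¹ * letterMap f l = z⁻¹ by group, norm_inv_eq] at n2
  omega

/-- The extra `cp` term carries the induction: it pays for half of the cancellation with the next
letter prepended, and `IsSpread` pays for the other half. -/
theorem length_lt (hf : IsSpread f) (L : List (B × Bool)) (l : B × Bool)
    (h : IsReduced (l :: L)) : BeginsWith f l (f (mk (l :: L))) ∧
      ∀ k ≠ l, L.length + cp (letterMap f k) (letterMap f l) < (f (mk (l :: L))).norm := by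
  induction L generalizing l with
  | nil =>
    refine ⟨hf.beginsWith l, fun k hk => ?_⟩
    have := hf k l l hk (fun h => by simpa using congrArg Prod.snd h)
    change 0 + _ < (letterMap f l).norm
    omega
  | cons m L ih =>
    obtain ⟨ih1, ih2⟩ := ih m (List.IsChain.tail h)
    have hlm : m ≠ (l.1, !l.2) := by
      rintro rfl
      have := (isReduced_cons_cons.mp h).1
      simp at this
    have h1 := hf.cons hlm ih1
    have h2 : f (mk (l :: m :: L)) = letterMap f l * f (mk (m :: L)) := by
      rw [letterMap, ← _root_.map_mul, mul_mk]; rfl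
    rw [h2]
    refine ⟨h1.1, fun k hk => ?_⟩
    have h3 := ih2 _ hlm.symm
    rw [letterMap_not] at h3
    have h4 := hf k l m hk hlm
    simp only [List.length_cons]
    omega

theorem norm_le [DecidableEq B] (hf : IsSpread f) (x : FreeGroup B) : x.norm ≤ (f x).norm := by
  have hr := isReduced_toWord (x := x)
  conv_rhs => rw [← mk_toWord (x := x)]
  rw [norm]
  cases h : x.toWord with
  | nil => simp
  | cons l L =>
    rw [h] at hr
    have := (hf.length_lt L l hr).2 (l.1, !l.2) (fun h => by simpa using congrArg Prod.snd h)
    simp only [List.length_cons]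
    omega

end IsSpread

/-! ### Minimal pairs that generate, or have a short commutator, consist of letters. -/

namespace IsMinPair

variable {R : Set (FreeGroup A × FreeGroup A)}

/-- A factor loses less than half of itself against its own generator and at most half against the
other one. If both neighbours involve the other generator, `cp_bounds` limits the two losses
together to half. -/
theorem isSpread {f : FreeGroup (Fin 2) →* FreeGroup A} (h : IsMinPair R (f (of 0)) (f (of 1)))
    (hR : IsNielsenClosed R) (hx : f (of 0) ≠ 1) (hy : f (of 1) ≠ 1) : IsSpread f := by
  obtain ⟨e1, e2, e3, e4⟩ := letterMap_cases f
  set x := f (of 0)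
  set y := f (of 1)
  obtain ⟨p1, p2, p3, p4, q1, q2, q3, q4⟩ := h.cp_bounds hR hx hy
  have r1 := two_mul_cp_inv_lt hx
  have r2 := two_mul_cp_inv_lt hy
  have s1 := min_cp_le x⁻¹ x y
  have s2 := min_cp_le x⁻¹ x y⁻¹
  have s3 := min_cp_le x x⁻¹ y
  have s4 := min_cp_le x x⁻¹ y⁻¹
  have s5 := min_cp_le x y y⁻¹
  have s6 := min_cp_le x y⁻¹ y
  have s7 := min_cp_le x⁻¹ y y⁻¹
  have s8 := min_cp_le x⁻¹ y⁻¹ y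
  have hx0 : x.norm ≠ 0 := fun h => hx (norm_eq_zero.mp h)
  have hy0 : y.norm ≠ 0 := fun h => hy (norm_eq_zero.mp h)
  rw [cp_comm x⁻¹ x] at s1 s2
  rw [cp_comm y⁻¹ y] at s6 s8
  rintro ⟨k, bk⟩ ⟨l, bl⟩ ⟨m, bm⟩
  have c1 := cp_comm y x
  have c2 := cp_comm y⁻¹ x
  have c3 := cp_comm y x⁻¹
  have c4 := cp_comm y⁻¹ x⁻¹
  have c5 := cp_comm x⁻¹ x
  have c6 := cp_comm y⁻¹ y
  fin_cases k <;> fin_cases l <;> fin_cases m <;> cases bk <;> cases bl <;> cases bm <;>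
    simp [e1, e2, e3, e4, c1, c2, c3, c4, c5, c6] <;> omega

/-- By `IsSpread.norm_le` preimages of generators are single letters. Two distinct generators are
not inverse to each other, so both letters of the source occur. -/
theorem norm_eq_one_of_surjective {f : FreeGroup (Fin 2) →* FreeGroup A}
    (hf : IsSpread f) {z w : FreeGroup (Fin 2)} {s t : A} (hst : s ≠ t) (hz : f z = of s)
    (hw : f w = of t) : (f (of 0)).norm = 1 ∧ (f (of 1)).norm = 1 := by
  obtain ⟨e1, e2, e3, e4⟩ := letterMap_cases f
  have key : ∀ {z : FreeGroup (Fin 2)} {s : A}, f z = of s → ∃ l, letterMap f l = of s := by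
    intro z s hz
    have h1 := hf.norm_le z
    rw [hz, norm_of, norm] at h1
    have h2 := mk_toWord (x := z)
    match hL : z.toWord, h1 with
    | [], _ =>
      rw [hL, ← one_eq_mk] at h2
      rw [← h2, _root_.map_one] at hz
      exact absurd hz (one_ne_of s)
    | [l], _ => exact ⟨l, by rw [letterMap, ← hL, h2, hz]⟩
  obtain ⟨⟨k, bk⟩, hk⟩ := key hz
  obtain ⟨⟨l, bl⟩, hl⟩ := key hw
  have nk := congrArg norm hk
  have nl := congrArg norm hl
  have hne : (of s : FreeGroup A) ≠ of t := fun h => hst (of_injective h)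
  have hne' : (of s : FreeGroup A)⁻¹ ≠ of t := fun h => by
    have := congrArg toWord h
    simp [toWord_inv, invRev] at this
  rw [norm_of] at nk nl
  fin_cases k <;> fin_cases l <;> cases bk <;> cases bl <;>
    simp_all [inv_eq_iff_eq_inv]

end IsMinPair

/-- The four junctions of the cyclic word x⁻¹y⁻¹xy realize the four prefix lengths, each once. The
condition on z is reproduced, so the formula iterates to powers of the commutator. -/
theorem IsSpread.norm_commutator_mul {f : FreeGroup (Fin 2) →* FreeGroup A} (hf : IsSpread f)
    {z : FreeGroup A} (hz : BeginsWith f (0, false) z) :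
    BeginsWith f (0, false) ((f (of 0))⁻¹ * (f (of 1))⁻¹ * f (of 0) * f (of 1) * z) ∧
    ((f (of 0))⁻¹ * (f (of 1))⁻¹ * f (of 0) * f (of 1) * z).norm +
      2 * (cp (f (of 0)) (f (of 1)) + cp (f (of 0)) (f (of 1))⁻¹ + cp (f (of 0))⁻¹ (f (of 1)) +
        cp (f (of 0))⁻¹ (f (of 1))⁻¹) = z.norm + 2 * ((f (of 0)).norm + (f (of 1)).norm) := by
  obtain ⟨e1, e2, e3, e4⟩ := letterMap_cases f
  have h1 := hf.cons (l := (1, true)) (m := (0, false)) (by simp) hz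
  have h2 := hf.cons (l := (0, true)) (m := (1, true)) (by simp) h1.1
  have h3 := hf.cons (l := (1, false)) (m := (0, true)) (by simp) h2.1
  have h4 := hf.cons (l := (0, false)) (m := (1, false)) (by simp) h3.1
  simp only [e1, e2, e3, e4, inv_inv, norm_inv_eq] at h1 h2 h3 h4
  rw [cp_comm (f (of 1))⁻¹] at h1
  rw [cp_comm (f (of 1))] at h3
  rw [show (f (of 0))⁻¹ * (f (of 1))⁻¹ * f (of 0) * f (of 1) * z =
    (f (of 0))⁻¹ * ((f (of 1))⁻¹ * (f (of 0) * (f (of 1) * z))) by group]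
  exact ⟨h4.1, by omega⟩

/-- The n-th power of w⁻¹cw has length at most 4n + 2|w|, so the growth rate of the commutator
powers is at most 4. With `cp_bounds` this leaves only |x| = |y| = 1. -/
theorem IsMinPair.norm_eq_one_of_commutator {R : Set (FreeGroup A × FreeGroup A)}
    {f : FreeGroup (Fin 2) →* FreeGroup A} (h : IsMinPair R (f (of 0)) (f (of 1)))
    (hR : IsNielsenClosed R) (hx : f (of 0) ≠ 1) (hy : f (of 1) ≠ 1) {w c : FreeGroup A}
    (hc : c.norm ≤ 4)
    (hw : (f (of 0))⁻¹ * (f (of 1))⁻¹ * f (of 0) * f (of 1) = w⁻¹ * c * w) :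
    (f (of 0)).norm = 1 ∧ (f (of 1)).norm = 1 := by
  have hf := h.isSpread hR hx hy
  have hx0 : (f (of 0)).norm ≠ 0 := fun h => hx (norm_eq_zero.mp h)
  have hy0 : (f (of 1)).norm ≠ 0 := fun h => hy (norm_eq_zero.mp h)
  obtain ⟨p1, p2, p3, p4, q1, q2, q3, q4⟩ := h.cp_bounds hR hx hy
  have hn := fun z => hf.norm_commutator_mul (z := z)
  rw [hw] at hn
  set x := f (of 0)
  set y := f (of 1)
  have hbase : BeginsWith f (0, false) x⁻¹ := (letterMap_cases f).2.1 ▸ hf.beginsWith (0, false)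
  have lower : ∀ n : ℕ, BeginsWith f (0, false) ((w⁻¹ * c * w) ^ n * x⁻¹) ∧
      ((w⁻¹ * c * w) ^ n * x⁻¹).norm + n * (2 * (cp x y + cp x y⁻¹ + cp x⁻¹ y + cp x⁻¹ y⁻¹)) =
        x.norm + n * (2 * (x.norm + y.norm)) := by
    intro n
    induction n with
    | zero => simpa using hbase
    | succ n ih =>
      have := hn _ ih.1
      rw [pow_succ', mul_assoc]
      refine ⟨this.1, ?_⟩
      rw [add_one_mul n, add_one_mul n]
      omega
  have upper : ∀ n : ℕ, (c ^ n).norm ≤ n * 4 := by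
    intro n
    induction n with
    | zero => simp
    | succ n ih =>
      have := norm_mul_le (c ^ n) c
      rw [pow_succ]
      omega
  have hK : x.norm + y.norm ≤ cp x y + cp x y⁻¹ + cp x⁻¹ y + cp x⁻¹ y⁻¹ + 2 := by
    -- An exponent larger than the bounded contribution 2|w| of the conjugator.
    set n := 2 * w.norm + 1 with hn
    have l := (lower n).2
    have u := upper n
    have c1 : (w⁻¹ * c * w) ^ n = w⁻¹ * c ^ n * w := by
      have := conj_pow (i := n) (a := w⁻¹) (b := c)
      rwa [inv_inv] at this
    rw [c1] at l
    have b1 := norm_mul (w⁻¹ * c ^ n * w) x⁻¹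
    have b2 := norm_mul_le (w⁻¹ * c ^ n) w
    have b3 := norm_mul_le w⁻¹ (c ^ n)
    rw [norm_inv_eq] at b1 b3
    by_contra! hlt
    have : n * (2 * (cp x y + cp x y⁻¹ + cp x⁻¹ y + cp x⁻¹ y⁻¹) + 5) ≤
      n * (2 * (x.norm + y.norm)) := Nat.mul_le_mul_left n (by omega)
    rw [Nat.mul_add] at this
    omega
  omega

end FreeGroup

namespace NielsenF2

/-! Normal forms in a group generated by `A` and `d`, modelled on `GL(2, ℤ)`. -/

section normalForm

variable {G : Type*} [Group G]

/-- The relations between a transvection `A`, the coordinate swap `d`, a reflection `e` and the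
central element `z` of `GL(2, ℤ)`. -/
structure IsGL2System (A d e z : G) : Prop where
  dd : d * d = 1
  ee : e * e = 1
  zz : z * z = 1
  dede : d * e * (d * e) = z
  zA : z * A = A * z
  eAe : e * A * e = A⁻¹
  braid : A⁻¹ * d * A * d * A⁻¹ = d * e

/-- The elements that are the product of a positive word in `A` and `d` with diagonal
elements. -/
def HasNormalForm (A d e z x : G) : Prop :=
  ∃ i j k : ℕ, ∃ p ∈ Submonoid.closure {A, d}, x = z ^ i * e ^ j * p * e ^ k

namespace IsGL2System

variable {A d e z : G}

theorem de (h : IsGL2System A d e z) : d * e = z * e * d := by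
  rw [← h.dede]
  simp only [mul_assoc, h.ee, mul_one]
  rw [h.dd, mul_one]

theorem ed (h : IsGL2System A d e z) : e * d = d * z * e := by
  rw [← h.dede]
  simp only [← mul_assoc, h.dd, one_mul]
  rw [mul_assoc _ e e, h.ee, mul_one]

theorem z_eq (h : IsGL2System A d e z) : z = e * d * (e * d) := by
  rw [← inv_eq_of_mul_eq_one_right h.zz, ← h.dede]
  simp only [mul_inv_rev, inv_eq_of_mul_eq_one_right h.dd, inv_eq_of_mul_eq_one_right h.ee]

theorem ze (h : IsGL2System A d e z) : z * e = e * z := by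
  conv_rhs => rw [h.z_eq]
  rw [← h.dede]
  simp only [← mul_assoc, h.ee, one_mul]
  rw [mul_assoc _ e e, h.ee, mul_one]

theorem zd (h : IsGL2System A d e z) : z * d = d * z := by
  conv_lhs => rw [h.z_eq]
  rw [← h.dede]
  simp only [← mul_assoc, h.dd, one_mul]
  rw [mul_assoc _ d d, h.dd, mul_one]

/-- The rewriting rule that removes an inverse: A⁻¹ disappears on meeting Ad, at the cost of a
diagonal element on the right. -/
theorem AdA (h : IsGL2System A d e z) : A * d * A⁻¹ = d * A * d * e := by
  rw [mul_assoc _ d e, ← h.braid]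
  simp only [mul_assoc, mul_inv_cancel_left]
  rw [← mul_assoc d d, h.dd, one_mul]

theorem commute_z (h : IsGL2System A d e z) {p : G} (hp : p ∈ Submonoid.closure {A, d}) :
    z * p = p * z := by
  have hle : Submonoid.closure {A, d} ≤ Submonoid.centralizer {z} := by
    rw [Submonoid.closure_le]
    rintro y (rfl | rfl)
    · exact Submonoid.mem_centralizer_iff.mpr fun _ hz => hz ▸ h.zA
    · exact Submonoid.mem_centralizer_iff.mpr fun _ hz => hz ▸ h.zd
  exact Submonoid.mem_centralizer_iff.mp (hle hp) z rfl

theorem mul_normalForm (h : IsGL2System A d e z) {x : G} (hx : HasNormalForm A d e z x)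
    (i j k : ℕ) : HasNormalForm A d e z (z ^ i * e ^ j * x * e ^ k) := by
  obtain ⟨i', j', k', p, hp, rfl⟩ := hx
  have hc : Commute (e ^ j) (z ^ i') := (show Commute e z from h.ze.symm).pow_pow j i'
  refine ⟨i + i', j + j', k' + k, p, hp, ?_⟩
  rw [pow_add, pow_add, pow_add]
  simp only [mul_assoc]
  rw [← mul_assoc (e ^ j) (z ^ i'), hc.eq]
  simp only [mul_assoc]

theorem normalForm_of_mem {p : G} (hp : p ∈ Submonoid.closure {A, d}) :
    HasNormalForm A d e z p :=
  ⟨0, 0, 0, p, hp, by simp⟩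

/-- The two claims are proved together because a final d in p exchanges them. A final A is cancelled
in the first and absorbed by `AdA` in the second. -/
theorem normalForm_mul_inv (h : IsGL2System A d e z) {p : G}
    (hp : p ∈ Submonoid.closure {A, d}) :
    HasNormalForm A d e z (p * A⁻¹) ∧ HasNormalForm A d e z (p * d * A⁻¹) := by
  have hA : A ∈ Submonoid.closure {A, d} := Submonoid.subset_closure (by simp)
  have hd : d ∈ Submonoid.closure {A, d} := Submonoid.subset_closure (by simp)
  induction hp using Submonoid.closure_induction_right with
  | one =>
    refine ⟨⟨0, 1, 1, A, hA, by simp [h.eAe]⟩, ⟨1, 1, 1, d * A, mul_mem hd hA, ?_⟩⟩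
    rw [one_mul, ← h.eAe]
    simp only [pow_one, ← mul_assoc]
    rw [h.de]
  | mul_right q hq y hy ih =>
    rcases hy with rfl | rfl
    · refine ⟨by simpa using normalForm_of_mem hq, ?_⟩
      have := h.mul_normalForm (normalForm_of_mem (mul_mem (mul_mem (mul_mem hq hd) hA) hd)) 0 0 1
      convert this using 1
      rw [mul_assoc, mul_assoc, ← mul_assoc y, h.AdA]
      simp [mul_assoc]
    · refine ⟨ih.2, ?_⟩
      rw [mul_assoc q, h.dd, mul_one]
      exact ih.1

theorem normalForm (h : IsGL2System A d e z) {x : G} (hx : x ∈ Subgroup.closure {A, d}) :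
    HasNormalForm A d e z x := by
  have hA : A ∈ Submonoid.closure {A, d} := Submonoid.subset_closure (by simp)
  have hd : d ∈ Submonoid.closure {A, d} := Submonoid.subset_closure (by simp)
  have hpow : ∀ k, e ^ k = 1 ∨ e ^ k = e := fun k => by
    rw [pow_eq_pow_mod k ((pow_two e).trans h.ee)]
    rcases Nat.mod_two_eq_zero_or_one k with hk | hk <;> simp [hk]
  have right_d : ∀ y, HasNormalForm A d e z y → HasNormalForm A d e z (y * d) := by
    rintro _ ⟨i, j, k, p, hp, rfl⟩
    have hpd := normalForm_of_mem (e := e) (z := z) (mul_mem hp hd)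
    rcases hpow k with hk | hk <;> rw [hk]
    · convert h.mul_normalForm hpd i j 0 using 1
      simp [mul_assoc]
    · convert h.mul_normalForm (h.mul_normalForm hpd 1 0 1) i j 0 using 1
      have hp' := h.commute_z hp
      simp only [pow_zero, pow_one, mul_one, mul_assoc] at hp' ⊢
      rw [h.ed, mul_assoc d, ← mul_assoc d, ← h.zd, ← mul_assoc p, ← mul_assoc p, ← hp']
      simp only [mul_assoc]
  induction hx using Subgroup.closure_induction_right with
  | one => exact normalForm_of_mem (one_mem _)
  | mul_right y hy w hw ih =>
    rcases hw with rfl | rfl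
    · obtain ⟨i, j, k, p, hp, rfl⟩ := ih
      rcases hpow k with hk | hk <;> rw [hk]
      · convert h.mul_normalForm (normalForm_of_mem (mul_mem hp hA)) i j 0 using 1
        simp [mul_assoc]
      · convert h.mul_normalForm (h.normalForm_mul_inv hp).1 i j 1 using 1
        rw [← h.eAe]
        simp [mul_assoc, h.ee]
    · exact right_d _ ih
  | mul_inv_cancel y hy w hw ih =>
    rcases hw with rfl | rfl
    · obtain ⟨i, j, k, p, hp, rfl⟩ := ih
      rcases hpow k with hk | hk <;> rw [hk]
      · convert h.mul_normalForm (h.normalForm_mul_inv hp).1 i j 0 using 1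
        simp [mul_assoc]
      · convert h.mul_normalForm (normalForm_of_mem (mul_mem hp hA)) i j 1 using 1
        rw [← h.eAe]
        simp only [mul_assoc, pow_one]
        rw [← mul_assoc e e, h.ee, one_mul]
    · rw [inv_eq_of_mul_eq_one_right h.dd]
      exact right_d _ ih

end IsGL2System

end normalForm

/-! The outer automorphism group and its action on `ℤ²`. -/

/-- `ε(u, v) = (u, v⁻¹)`. -/
def ε : MulAut F2 := (endo u v⁻¹).toMulEquiv (endo u v⁻¹)
  (F2.hom_ext (by simp) (by simp)) (F2.hom_ext (by simp) (by simp))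

@[simp] theorem ε_u : ε u = u := endo_u u v⁻¹
@[simp] theorem ε_v : ε v = v⁻¹ := endo_v u v⁻¹

@[simp] theorem α_symm_u : α.symm u = u := endo_u u (u * v)
@[simp] theorem α_symm_v : α.symm v = u * v := endo_v u (u * v)

/-- The outer automorphism group of `F₂`. -/
abbrev Out : Type := MulAut F2 ⧸ Int

theorem mk_eq_mk {f g : MulAut F2} (w : F2) (hu : f u = w * g u * w⁻¹)
    (hv : f v = w * g v * w⁻¹) : (f : Out) = g := by
  have h : f = inner w * g := F2.aut_ext (by simpa [inner] using hu) (by simpa [inner] using hv)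
  have hw : inner w ∈ Int := ⟨w, rfl⟩
  rw [h, QuotientGroup.mk_mul, (QuotientGroup.eq_one_iff (inner w)).mpr hw, one_mul]

/-- The relations `zA`, `eAe` and `braid` hold only up to the indicated conjugation by u or u⁻¹,
which is why the normal form lives in the outer automorphism group. -/
theorem isGL2System : IsGL2System (G := Out) ((α⁻¹ : MulAut F2) : Out) (δ : Out) (ε : Out)
    ((δ * ε * (δ * ε) : MulAut F2) : Out) where
  dd := mk_eq_mk (f := δ * δ) (g := 1) 1 (by simp) (by simp)
  ee := mk_eq_mk (f := ε * ε) (g := 1) 1 (by simp) (by simp)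
  zz := mk_eq_mk (f := δ * ε * (δ * ε) * (δ * ε * (δ * ε))) (g := 1) 1 (by simp) (by simp)
  dede := rfl
  zA := mk_eq_mk (f := δ * ε * (δ * ε) * α⁻¹) (g := α⁻¹ * (δ * ε * (δ * ε))) u⁻¹
    (by simp) (by simp [mul_assoc])
  eAe := mk_eq_mk (f := ε * α⁻¹ * ε) (g := α⁻¹⁻¹) u (by simp) (by simp [mul_assoc])
  braid := mk_eq_mk (f := α⁻¹⁻¹ * δ * α⁻¹ * δ * α⁻¹⁻¹) (g := δ * ε) u⁻¹
    (by simp [mul_assoc]) (by simp [mul_assoc])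

theorem ρ_apply (f : MulAut F2) : (ρ f : Matrix (Fin 2) (Fin 2) ℤ) = abMatrix f.toMonoidHom := rfl

theorem ab_u : (ab u).toAdd = ![1, 0] := by
  ext i
  fin_cases i <;> simp [ab, u]

theorem ab_v : (ab v).toAdd = ![0, 1] := by
  ext i
  fin_cases i <;> simp [ab, v]

theorem abMatrix_eq (f : F2 →* F2) : abMatrix f =
    !![(ab (f u)).toAdd 0, (ab (f v)).toAdd 0; (ab (f u)).toAdd 1, (ab (f v)).toAdd 1] := by
  ext i j
  fin_cases i <;> fin_cases j <;> rfl

theorem Int_le_ker : Int ≤ ρ.ker := by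
  rintro _ ⟨w, rfl⟩
  rw [MonoidHom.mem_ker]
  ext i j
  simp [ρ_apply, abMatrix, ab, Matrix.one_apply, Pi.single_apply]

/-- The morphism `Out(F₂) → GL(2, ℤ)`. -/
def ρOut : Out →* GL (Fin 2) ℤ := QuotientGroup.lift Int ρ Int_le_ker

theorem coe_ρ (f : MulAut F2) : (ρ f : Matrix (Fin 2) (Fin 2) ℤ) =
    !![(ab (f u)).toAdd 0, (ab (f v)).toAdd 0; (ab (f u)).toAdd 1, (ab (f v)).toAdd 1] :=
  abMatrix_eq f.toMonoidHom

theorem coe_ρ_α_inv : (ρ α⁻¹ : Matrix (Fin 2) (Fin 2) ℤ) = !![1, 1; 0, 1] := by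
  rw [coe_ρ]; simp [ab_u, ab_v]

theorem coe_ρ_δ : (ρ δ : Matrix (Fin 2) (Fin 2) ℤ) = !![0, 1; 1, 0] := by
  rw [coe_ρ]; simp [ab_u, ab_v]

theorem coe_ρ_ε : (ρ ε : Matrix (Fin 2) (Fin 2) ℤ) = !![1, 0; 0, -1] := by
  rw [coe_ρ]; simp [ab_u, ab_v]

theorem coe_ρOut_mk (f : MulAut F2) : ρOut f = ρ f := rfl

/-- Right multiplication by α⁻¹ adds the first column to the second and δ swaps columns, so the
entry sum never decreases, and it reaches 3 as soon as α⁻¹ is applied to 1 or δ. The alternatives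
identify p itself, not merely its matrix. -/
theorem positive_of_mem {p : Out}
    (hp : p ∈ Submonoid.closure {((α⁻¹ : MulAut F2) : Out), (δ : Out)}) :
    (∀ i j, 0 ≤ (ρOut p : Matrix (Fin 2) (Fin 2) ℤ) i j) ∧
      (p = 1 ∨ p = (δ : Out) ∨ 3 ≤ ∑ i, ∑ j, (ρOut p : Matrix (Fin 2) (Fin 2) ℤ) i j) := by
  induction hp using Submonoid.closure_induction_right with
  | one =>
    refine ⟨fun i j => ?_, Or.inl rfl⟩
    fin_cases i <;> fin_cases j <;> simp
  | mul_right q hq y hy ih =>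
    obtain ⟨h0, h⟩ := ih
    have h00 := h0 0 0
    have h01 := h0 0 1
    have h10 := h0 1 0
    have h11 := h0 1 1
    rcases hy with rfl | rfl
    · have hm : (ρOut (q * ((α⁻¹ : MulAut F2) : Out)) : Matrix (Fin 2) (Fin 2) ℤ) =
          (ρOut q : Matrix (Fin 2) (Fin 2) ℤ) * !![1, 1; 0, 1] := by
        rw [map_mul, Units.val_mul, coe_ρOut_mk, coe_ρ_α_inv]
      rw [hm]
      refine ⟨fun i j => ?_, Or.inr (Or.inr ?_)⟩
      · fin_cases i <;> fin_cases j <;> simp [Matrix.mul_apply, Fin.sum_univ_two] <;> omega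
      · rcases h with rfl | rfl | h
        · simp [Fin.sum_univ_two]
        · rw [coe_ρOut_mk, coe_ρ_δ]
          simp [Fin.sum_univ_two]
        · simp [Matrix.mul_apply, Fin.sum_univ_two] at h ⊢
          omega
    · have hm : (ρOut (q * (δ : Out)) : Matrix (Fin 2) (Fin 2) ℤ) =
          (ρOut q : Matrix (Fin 2) (Fin 2) ℤ) * !![0, 1; 1, 0] := by
        rw [map_mul, Units.val_mul, coe_ρOut_mk, coe_ρ_δ]
      rw [hm]
      refine ⟨fun i j => ?_, ?_⟩
      · fin_cases i <;> fin_cases j <;> simp [Matrix.mul_apply, Fin.sum_univ_two] <;> omega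
      · rcases h with rfl | rfl | h
        · exact Or.inr (Or.inl (one_mul _))
        · exact Or.inl isGL2System.dd
        · refine Or.inr (Or.inr ?_)
          simp [Matrix.mul_apply, Fin.sum_univ_two] at h ⊢
          omega

/-- The diagonal sign factors of the normal form force the matrix of p to be diagonal with entries
±1, hence the identity by positivity. So p = 1, and the remaining signs must cancel. -/
theorem eq_one_of_ρOut_eq_one {x : Out}
    (hx : x ∈ Subgroup.closure {((α⁻¹ : MulAut F2) : Out), (δ : Out)}) (h1 : ρOut x = 1) :
    x = 1 := by
  obtain ⟨i, j, k, p, hp, rfl⟩ := isGL2System.normalForm hx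
  have hz : (ρOut ((δ * ε * (δ * ε) : MulAut F2) : Out) : Matrix (Fin 2) (Fin 2) ℤ) =
      !![-1, 0; 0, -1] := by
    rw [coe_ρOut_mk, map_mul, map_mul, Units.val_mul, Units.val_mul, coe_ρ_δ, coe_ρ_ε]
    simp
  have he : (ρOut (ε : Out) : Matrix (Fin 2) (Fin 2) ℤ) = !![1, 0; 0, -1] := by
    rw [coe_ρOut_mk, coe_ρ_ε]
  have h1' : (ρOut _ : Matrix (Fin 2) (Fin 2) ℤ) = 1 := congrArg Units.val h1
  have hpos := positive_of_mem hp
  have ez := (pow_two _).trans isGL2System.zz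
  have ee := (pow_two _).trans isGL2System.ee
  rw [pow_eq_pow_mod i ez, pow_eq_pow_mod j ee, pow_eq_pow_mod k ee] at h1' ⊢
  set M := (ρOut p : Matrix (Fin 2) (Fin 2) ℤ) with hM
  have hd : p = (δ : Out) → M = !![0, 1; 1, 0] := fun h => by rw [hM, h, coe_ρOut_mk, coe_ρ_δ]
  obtain ⟨h0, h⟩ := hpos
  have h00 := h0 0 0
  have h01 := h0 0 1
  have h10 := h0 1 0
  have h11 := h0 1 1
  have hη : M = !![M 0 0, M 0 1; M 1 0, M 1 1] := Matrix.eta_fin_two M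
  simp only [map_mul, map_pow, Units.val_mul, Units.val_pow_eq_pow_val, hz, he] at h1'
  rw [← hM, hη] at h1'
  have t := Matrix.ext_iff.mpr h1'
  have t00 := t 0 0
  have t01 := t 0 1
  have t10 := t 1 0
  have t11 := t 1 1
  have hone : p = 1 → M = 1 := fun h => by rw [hM, h, map_one, Units.val_one]
  have hsum : ∑ i, ∑ j, M i j = M 0 0 + M 0 1 + (M 1 0 + M 1 1) := by
    simp [Fin.sum_univ_two]
  rw [hsum] at h
  have hd01 : p = (δ : Out) → M 0 1 = 1 := fun h => by rw [hd h]; rfl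
  have h100 : p = 1 → M 0 0 = 1 := fun h => by rw [hone h]; rfl
  have h111 : p = 1 → M 1 1 = 1 := fun h => by rw [hone h]; rfl
  have hee := isGL2System.ee
  rcases Nat.mod_two_eq_zero_or_one i with hi | hi <;>
  rcases Nat.mod_two_eq_zero_or_one j with hj | hj <;>
  rcases Nat.mod_two_eq_zero_or_one k with hk | hk <;>
  rw [hi, hj, hk] at t00 t01 t10 t11 ⊢ <;>
  simp at t00 t01 t10 t11 ⊢ <;>
  rcases h with h | h | h <;>
  first
  | exact absurd (hd01 h) (by omega)
  | (exfalso; omega)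
  | exact absurd (h100 h) (by omega)
  | exact absurd (h111 h) (by omega)
  | simp [h, hee]

end NielsenF2

namespace NielsenF2

/-! Generation of `Aut(F₂)`. -/

theorem F2.mem_of_mem {H : Subgroup F2} (hu : u ∈ H) (hv : v ∈ H) (x : F2) : x ∈ H := by
  have h : (⊤ : Subgroup F2) ≤ H := by
    rw [← FreeGroup.closure_range_of, Subgroup.closure_le]
    rintro _ ⟨i, rfl⟩
    fin_cases i
    · exact hu
    · exact hv
  exact h (Subgroup.mem_top x)

theorem uv_ne_vu : u * v ≠ v * u := by
  rw [← FreeGroup.toWord_injective.ne_iff]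
  decide

theorem Φ_range_le {H : Subgroup (MulAut F2)} (ha : α ∈ H) (hb : β ∈ H) (hd : δ ∈ H) :
    Φ.range ≤ H := by
  rintro _ ⟨⟨x, e⟩, rfl⟩
  change Ψ x * Δ.lift δ δδ e ∈ H
  have hx : (⊤ : Subgroup B3) ≤ H.comap Ψ := by
    rw [← PresentedGroup.closure_range_of, Subgroup.closure_le]
    rintro _ ⟨i, rfl⟩
    fin_cases i
    · change Ψ B3.a ∈ H
      simpa [Ψ] using ha
    · change Ψ B3.b ∈ H
      simpa [Ψ] using hb
  refine mul_mem (hx (Subgroup.mem_top x)) ?_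
  rcases Δ.eq_one_or_d e with rfl | rfl
  · rw [map_one]
    exact one_mem H
  · rwa [Δ.lift_d]

theorem α_mem : α ∈ Φ.range := ⟨_, Φ_a⟩
theorem δ_mem : δ ∈ Φ.range := ⟨_, Φ_d⟩

/-- The subgroup of `Aut(F₂)` generated by `Int(F₂)` and `Φ(DB₃)`. -/
abbrev nielsenSubgroup : Subgroup (MulAut F2) := Int ⊔ Φ.range

theorem mem_nielsenSubgroup_iff {f : MulAut F2} :
    f ∈ nielsenSubgroup ↔ ∃ w, ∃ g ∈ Φ.range, f = inner w * g := by
  rw [← SetLike.mem_coe, nielsenSubgroup, Subgroup.normal_mul]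
  constructor
  · rintro ⟨_, ⟨w, rfl⟩, g, hg, rfl⟩
    exact ⟨w, g, hg, rfl⟩
  · rintro ⟨w, g, hg, rfl⟩
    exact ⟨_, ⟨w, rfl⟩, g, hg, rfl⟩

theorem mk_mem_closure {f : MulAut F2} (hf : f ∈ nielsenSubgroup) :
    (f : Out) ∈ Subgroup.closure {((α⁻¹ : MulAut F2) : Out), (δ : Out)} := by
  have hA : α ∈ (Subgroup.closure {((α⁻¹ : MulAut F2) : Out), (δ : Out)}).comap
      (QuotientGroup.mk' Int) := by
    rw [← inv_mem_iff]
    exact Subgroup.subset_closure (Or.inl rfl)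
  have hd : δ ∈ (Subgroup.closure {((α⁻¹ : MulAut F2) : Out), (δ : Out)}).comap
      (QuotientGroup.mk' Int) := Subgroup.subset_closure (Or.inr rfl)
  obtain ⟨w, g, hg, rfl⟩ := mem_nielsenSubgroup_iff.mp hf
  have hw : inner w ∈ Int := ⟨w, rfl⟩
  rw [QuotientGroup.mk_mul, (QuotientGroup.eq_one_iff (inner w)).mpr hw, one_mul]
  refine Φ_range_le hA ?_ hd hg
  rw [← inv_mem_iff, ← δαδ]
  exact mul_mem (mul_mem hd hA) (inv_mem hd)

theorem α_mem_nielsenSubgroup : α ∈ nielsenSubgroup := le_sup_right (a := Int) α_mem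
theorem δ_mem_nielsenSubgroup : δ ∈ nielsenSubgroup := le_sup_right (a := Int) δ_mem
theorem inner_mem_nielsenSubgroup (w : F2) : inner w ∈ nielsenSubgroup :=
  le_sup_left (b := Φ.range) ⟨w, rfl⟩

theorem ε_mem_nielsenSubgroup : ε ∈ nielsenSubgroup := by
  -- The `braid` relation of `isGL2System`, solved for ε and lifted to Aut(F₂) with its inner
  -- correction.
  have h : ε = inner v * (δ * (α * δ * α⁻¹ * δ * α)) := by
    apply F2.aut_ext <;> simp [inner, mul_assoc]
  have ha := α_mem_nielsenSubgroup
  have hd := δ_mem_nielsenSubgroup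
  rw [h]
  exact mul_mem (inner_mem_nielsenSubgroup _)
    (mul_mem hd (mul_mem (mul_mem (mul_mem (mul_mem ha hd) (inv_mem ha)) hd) ha))

/-- The pairs obtained from `(f(u), f(v))` by Nielsen moves and simultaneous conjugation. -/
def nielsenOrbit (f : F2 →* F2) : Set (F2 × F2) :=
  {p | ∃ w, ∃ n ∈ nielsenSubgroup, p.1 = w⁻¹ * f (n u) * w ∧ p.2 = w⁻¹ * f (n v) * w}

theorem isNielsenClosed_nielsenOrbit (f : F2 →* F2) :
    FreeGroup.IsNielsenClosed (nielsenOrbit f) where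
  conj := by
    rintro p _ _ ⟨w, n, hn, rfl, rfl⟩
    exact ⟨w * p, n, hn, by group, by group⟩
  swap := by
    rintro _ _ ⟨w, n, hn, rfl, rfl⟩
    exact ⟨w, n * δ, mul_mem hn δ_mem_nielsenSubgroup, by simp, by simp⟩
  inv := by
    rintro _ _ ⟨w, n, hn, rfl, rfl⟩
    exact ⟨w, n * (δ * ε * δ), mul_mem hn (mul_mem (mul_mem δ_mem_nielsenSubgroup
      ε_mem_nielsenSubgroup) δ_mem_nielsenSubgroup), by simp [mul_assoc], by simp⟩
  mul_inv := by
    rintro _ _ ⟨w, n, hn, rfl, rfl⟩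
    -- Conjugation by u turns the value u⁻¹v of α at v into vu⁻¹ and fixes u.
    exact ⟨w, n * (inner u * α), mul_mem hn (mul_mem (inner_mem_nielsenSubgroup u)
      α_mem_nielsenSubgroup), by simp [inner], by simp [inner, mul_assoc]⟩

theorem exists_isMinPair {R : Set (F2 × F2)} (hR : R.Nonempty) :
    ∃ x y, FreeGroup.IsMinPair R x y := by
  obtain ⟨⟨x, y⟩, h, hmin⟩ :=
    (measure fun p : F2 × F2 => p.1.norm + p.2.norm).wf.has_min R hR
  exact ⟨x, y, h, fun x' y' h' => not_lt.mp (hmin (x', y') h')⟩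

theorem eq_of_norm_eq_one {x : F2} (h : x.norm = 1) : x = u ∨ x = u⁻¹ ∨ x = v ∨ x = v⁻¹ := by
  have h2 := FreeGroup.mk_toWord (x := x)
  obtain ⟨⟨i, b⟩, hL⟩ := List.length_eq_one_iff.mp h
  rw [hL] at h2
  rw [← h2]
  fin_cases i <;> cases b
  · exact Or.inr (Or.inl rfl)
  · exact Or.inl rfl
  · exact Or.inr (Or.inr (Or.inr rfl))
  · exact Or.inr (Or.inr (Or.inl rfl))

theorem exists_mem_of_norm_eq_one {x y : F2} (hx : x.norm = 1) (hy : y.norm = 1) (h : x ≠ y)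
    (h' : x ≠ y⁻¹) : ∃ n ∈ nielsenSubgroup, n u = x ∧ n v = y := by
  have hd := δ_mem_nielsenSubgroup
  have he := ε_mem_nielsenSubgroup
  rcases eq_of_norm_eq_one hx with rfl | rfl | rfl | rfl <;>
    rcases eq_of_norm_eq_one hy with rfl | rfl | rfl | rfl <;>
    first
    | exact absurd rfl h
    | exact absurd rfl h'
    | exact absurd (inv_inv _).symm h'
    | (refine ⟨1, one_mem _, ?_, ?_⟩ <;> (simp; done))
    | (refine ⟨ε, he, ?_, ?_⟩ <;> (simp; done))
    | (refine ⟨δ, hd, ?_, ?_⟩ <;> (simp; done))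
    | (refine ⟨δ * ε, mul_mem hd he, ?_, ?_⟩ <;> (simp; done))
    | (refine ⟨ε * δ, mul_mem he hd, ?_, ?_⟩ <;> (simp; done))
    | (refine ⟨δ * ε * δ, mul_mem (mul_mem hd he) hd, ?_, ?_⟩ <;> (simp; done))
    | (refine ⟨δ * ε * δ * ε, mul_mem (mul_mem (mul_mem hd he) hd) he, ?_, ?_⟩ <;> (simp; done))
    | (refine ⟨ε * δ * ε, mul_mem (mul_mem he hd) he, ?_, ?_⟩ <;> simp)

/-- The conjugates of `[u, v]` and of its inverse. -/
def IsConjComm (x : F2) : Prop :=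
  ∃ w : F2, x = w⁻¹ * comm u v * w ∨ x = w⁻¹ * (comm u v)⁻¹ * w

theorem IsConjComm.map {x : F2} (hx : IsConjComm x) {f : F2 →* F2}
    (hf : IsConjComm (f (comm u v))) : IsConjComm (f x) := by
  obtain ⟨t, ht | ht⟩ := hf <;> obtain ⟨w, rfl | rfl⟩ := hx <;>
    simp only [_root_.map_mul, _root_.map_inv, ht]
  · exact ⟨t * f w, Or.inl (by group)⟩
  · exact ⟨t * f w, Or.inr (by group)⟩
  · exact ⟨t * f w, Or.inr (by group)⟩
  · exact ⟨t * f w, Or.inl (by group)⟩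

theorem map_comm {G H : Type*} [Group G] [Group H] (f : G →* H) (x y : G) :
    f (comm x y) = comm (f x) (f y) := by
  simp [comm]

theorem apply_comm_of_mem {g : MulAut F2} (hg : g ∈ Φ.range) :
    g (comm u v) = comm u v ∨ g (comm u v) = (comm u v)⁻¹ := by
  let H : Subgroup (MulAut F2) :=
    { carrier := {g | g (comm u v) = comm u v ∨ g (comm u v) = (comm u v)⁻¹}
      mul_mem' := by
        rintro f g (hf | hf) (hg | hg) <;> simp [hf, hg]
      one_mem' := by simp
      inv_mem' := by
        rintro f (hf | hf)
        · exact Or.inl (by rw [MulAut.inv_def, MulEquiv.symm_apply_eq, hf])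
        · exact Or.inr (by rw [MulAut.inv_def, MulEquiv.symm_apply_eq, _root_.map_inv, hf, inv_inv]) }
  refine Φ_range_le (H := H) (Or.inl ?_) (Or.inl ?_) (Or.inr ?_) hg <;> simp [comm, mul_assoc]

theorem isConjComm_apply_of_mem {n : MulAut F2} (hn : n ∈ nielsenSubgroup) :
    IsConjComm (n (comm u v)) := by
  obtain ⟨w, g, hg, rfl⟩ := mem_nielsenSubgroup_iff.mp hn
  rcases apply_comm_of_mem hg with h | h
  · exact ⟨w⁻¹, Or.inl (by rw [MulAut.mul_apply, h]; simp [inner])⟩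
  · exact ⟨w⁻¹, Or.inr (by rw [MulAut.mul_apply, h]; simp [inner])⟩

/-- Either hypothesis passes to every pair in the Nielsen orbit, so a minimal pair consists of two
independent letters. It is then the image of (u, v) under a signed permutation m, and undoing the
moves writes f as an inner automorphism times m n⁻¹. -/
theorem exists_mem_nielsenSubgroup {f : F2 →* F2}
    (hf : Function.Surjective f ∨ IsConjComm (f (comm u v))) :
    ∃ n ∈ nielsenSubgroup, MulEquiv.toMonoidHom n = f := by
  have hR := isNielsenClosed_nielsenOrbit f
  obtain ⟨x, y, h⟩ := exists_isMinPair
    (⟨(f u, f v), 1, 1, one_mem _, by simp, by simp⟩ : (nielsenOrbit f).Nonempty)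
  obtain ⟨w, n, hn, hx, hy⟩ := h.1
  simp only at hx hy
  have hg : ∀ z, endo x y z = w⁻¹ * f (n z) * w := by
    have : endo x y = ((MulAut.conj w⁻¹).toMonoidHom.comp f).comp n.toMonoidHom :=
      F2.hom_ext (by simp [hx]) (by simp [hy])
    intro z
    simp [this]
  have hgu : endo x y (FreeGroup.of 0) = x := endo_u x y
  have hgv : endo x y (FreeGroup.of 1) = y := endo_v x y
  have h' : FreeGroup.IsMinPair (nielsenOrbit f) (endo x y (.of 0)) (endo x y (.of 1)) := by
    rwa [hgu, hgv]
  have hconj : IsConjComm (f (comm u v)) → IsConjComm (comm x y) := by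
    intro hc
    have h1 := (isConjComm_apply_of_mem hn).map hc
    have h2 := hg (comm u v)
    rw [map_comm, endo_u, endo_v] at h2
    rw [h2]
    obtain ⟨t, ht | ht⟩ := h1 <;> rw [ht]
    · exact ⟨t * w, Or.inl (by group)⟩
    · exact ⟨t * w, Or.inr (by group)⟩
  have hsurj : Function.Surjective f → Function.Surjective (endo x y) := by
    intro hf z
    obtain ⟨t, ht⟩ := hf (w * z * w⁻¹)
    exact ⟨n⁻¹ t, by rw [hg, MulAut.apply_inv_self, ht]; group⟩
  have hne : x ≠ 1 ∧ y ≠ 1 := by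
    rcases hf with hf | hf
    · by_contra hc
      have hc' : x = 1 ∨ y = 1 := by tauto
      -- If one entry is trivial, xy is the other entry, so it generates the image in both cases and
      -- F₂ would be cyclic.
      have hmem : ∀ z, z ∈ Subgroup.zpowers (x * y) := by
        have : ∀ z, z ∈ (Subgroup.zpowers (x * y)).comap (endo x y) := by
          apply F2.mem_of_mem <;> rcases hc' with rfl | rfl <;> simp
        intro z
        obtain ⟨t, rfl⟩ := hsurj hf z
        exact this t
      obtain ⟨i, hi⟩ := hmem u
      obtain ⟨j, hj⟩ := hmem v
      exact uv_ne_vu (by rw [← hi, ← hj]; exact zpow_mul_comm _ i j)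
    · have hc : comm x y ≠ 1 := by
        intro h1
        have h2 : comm u v = 1 := by
          obtain ⟨t, ht | ht⟩ := hconj hf <;> rw [h1] at ht
          · rw [eq_comm, mul_eq_one_iff_eq_inv] at ht
            simpa using ht
          · rw [eq_comm, mul_eq_one_iff_eq_inv] at ht
            simpa using ht
        apply uv_ne_vu
        have := congrArg (v * u * ·) h2
        simpa [comm, mul_assoc] using this
      constructor <;> rintro rfl <;> simp [comm] at hc
  have hnorm : x.norm = 1 ∧ y.norm = 1 := by
    rcases hf with hf | hf
    · obtain ⟨a, ha⟩ := hsurj hf (FreeGroup.of 0)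
      obtain ⟨b, hb⟩ := hsurj hf (FreeGroup.of 1)
      have := FreeGroup.IsMinPair.norm_eq_one_of_surjective
        (h'.isSpread hR (hgu.symm ▸ hne.1) (hgv.symm ▸ hne.2)) zero_ne_one ha hb
      rwa [hgu, hgv] at this
    · obtain ⟨t, ht⟩ := hconj hf
      have key : ∀ c : F2, c.norm ≤ 4 → comm x y = t⁻¹ * c * t → x.norm = 1 ∧ y.norm = 1 := by
        intro c hc hct
        have := h'.norm_eq_one_of_commutator hR (hgu.symm ▸ hne.1) (hgv.symm ▸ hne.2)
          (w := t) hc (by rw [hgu, hgv]; exact hct)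
        rwa [hgu, hgv] at this
      have hc : (comm u v).norm ≤ 4 := by decide
      rcases ht with ht | ht
      · exact key _ hc ht
      · exact key _ (by rwa [FreeGroup.norm_inv_eq]) ht
  have hb := h.cp_bounds hR hne.1 hne.2
  -- If x = y^±1, the corresponding common prefix would have length 1, against the bound by half of
  -- |x| = 1.
  obtain ⟨m, hm, hmu, hmv⟩ := exists_mem_of_norm_eq_one hnorm.1 hnorm.2
    (by rintro rfl; have := FreeGroup.cp_self x; omega)
    (by rintro rfl; have := FreeGroup.cp_self y⁻¹; omega)
  refine ⟨inner w * m * n⁻¹, mul_mem (mul_mem (inner_mem_nielsenSubgroup w) hm) (inv_mem hn), ?_⟩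
  have hm' : m.toMonoidHom = endo x y := F2.hom_ext (by simpa using hmu) (by simpa using hmv)
  refine MonoidHom.ext fun z => ?_
  have h1 : m (n⁻¹ z) = w⁻¹ * f (n (n⁻¹ z)) * w := by
    rw [← hg, ← hm']
    rfl
  rw [MulAut.apply_inv_self] at h1
  change inner w (m (n⁻¹ z)) = f z
  rw [h1]
  simp [inner, mul_assoc]

end NielsenF2

namespace NielsenF2

/-! The centralizer of `[u, v]`. -/

/-- The integral Heisenberg group. -/
structure Heisenberg where
  x : ℤ
  y : ℤ
  z : ℤ

namespace Heisenberg

@[ext] theorem ext' {p q : Heisenberg} (hx : p.x = q.x) (hy : p.y = q.y) (hz : p.z = q.z) :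
    p = q := by
  cases p; cases q; simp_all

instance : Mul Heisenberg := ⟨fun p q => ⟨p.x + q.x, p.y + q.y, p.z + q.z + p.x * q.y⟩⟩
instance : One Heisenberg := ⟨⟨0, 0, 0⟩⟩
instance : Inv Heisenberg := ⟨fun p => ⟨-p.x, -p.y, -p.z + p.x * p.y⟩⟩

@[simp] theorem mul_x (p q : Heisenberg) : (p * q).x = p.x + q.x := rfl
@[simp] theorem mul_y (p q : Heisenberg) : (p * q).y = p.y + q.y := rfl
@[simp] theorem mul_z (p q : Heisenberg) : (p * q).z = p.z + q.z + p.x * q.y := rfl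
@[simp] theorem one_x : (1 : Heisenberg).x = 0 := rfl
@[simp] theorem one_y : (1 : Heisenberg).y = 0 := rfl
@[simp] theorem one_z : (1 : Heisenberg).z = 0 := rfl
@[simp] theorem inv_x (p : Heisenberg) : p⁻¹.x = -p.x := rfl
@[simp] theorem inv_y (p : Heisenberg) : p⁻¹.y = -p.y := rfl
@[simp] theorem inv_z (p : Heisenberg) : p⁻¹.z = -p.z + p.x * p.y := rfl

instance : Group Heisenberg := Group.ofLeftAxioms
  (fun p q r => by ext <;> simp <;> ring) (fun p => by ext <;> simp)
  (fun p => by ext <;> simp)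

theorem zpow_xy (p : Heisenberg) (n : ℤ) : (p ^ n).x = n * p.x ∧ (p ^ n).y = n * p.y := by
  induction n with
  | zero => simp
  | succ n ih =>
    rw [zpow_add_one, mul_x, mul_y, ih.1, ih.2]
    constructor <;> ring
  | pred n ih =>
    rw [zpow_sub_one, mul_x, mul_y, ih.1, ih.2, inv_x, inv_y]
    constructor <;> ring

theorem zpow_z {p : Heisenberg} (hx : p.x = 0) (n : ℤ) : (p ^ n).z = n * p.z := by
  induction n with
  | zero => simp
  | succ n ih =>
    rw [zpow_add_one, mul_z, ih, (zpow_xy p n).1, hx]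
    ring
  | pred n ih =>
    rw [zpow_sub_one, mul_z, ih, (zpow_xy p _).1, inv_z, hx]
    ring

end Heisenberg

/-- The morphism from `F₂` onto the Heisenberg group. -/
def toHeisenberg : F2 →* Heisenberg := FreeGroup.lift ![⟨1, 0, 0⟩, ⟨0, 1, 0⟩]

theorem toHeisenberg_comm : toHeisenberg (comm u v) = ⟨0, 0, 1⟩ := by
  ext <;> simp [toHeisenberg, comm, u, v]

/-- The image of [u,v] in the Heisenberg group is central with z-coordinate 1, while that of its
inverse has z-coordinate -1. -/
theorem conj_comm_ne_inv (x : F2) : x * comm u v * x⁻¹ ≠ (comm u v)⁻¹ := by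
  intro h
  have := congrArg (fun x => (toHeisenberg x).z) h
  simp [toHeisenberg_comm] at this
  lia

/-- An n-th root maps to a Heisenberg element with vanishing x-coordinate, where the central
coordinate is multiplicative in the exponent. Hence n divides 1. -/
theorem isUnit_of_zpow_eq_comm {z : F2} {n : ℤ} (h : z ^ n = comm u v) : IsUnit n := by
  have h1 := congrArg toHeisenberg h
  rw [map_zpow, toHeisenberg_comm] at h1
  have hx := (Heisenberg.zpow_xy (toHeisenberg z) n).1
  have hn : n ≠ 0 := by
    rintro rfl
    have := congrArg Heisenberg.z h1
    simp at this
  have hx0 : (toHeisenberg z).x = 0 := by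
    rw [h1] at hx
    simpa [hn] using hx.symm
  have hz := Heisenberg.zpow_z hx0 n
  rw [h1] at hz
  exact IsUnit.of_mul_eq_one _ hz.symm

theorem _root_.FreeGroup.subsingleton_of_commute {X : Type*}
    (h : ∀ a b : FreeGroup X, a * b = b * a) : Subsingleton X := by
  classical
  refine ⟨fun a b => ?_⟩
  by_contra hab
  have h1 := congrArg FreeGroup.toWord (h (.of a) (.of b))
  simp only [FreeGroup.of, FreeGroup.mul_mk, FreeGroup.toWord_mk] at h1
  rw [FreeGroup.IsReduced.reduce_eq (by simp), FreeGroup.IsReduced.reduce_eq (by simp)] at h1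
  simp at h1
  exact hab h1.1

theorem _root_.IsFreeGroup.exists_zpow_of_commute (G : Type*) [Group G] [IsFreeGroup G]
    (h : ∀ a b : G, a * b = b * a) : ∃ g : G, ∀ x : G, ∃ n : ℤ, g ^ n = x := by
  have e := IsFreeGroup.toFreeGroup G
  have hs : Subsingleton (IsFreeGroup.Generators G) :=
    FreeGroup.subsingleton_of_commute fun a b => by
      apply e.symm.injective
      rw [map_mul, map_mul, h]
  have hc : ∃ g, ∀ x : FreeGroup (IsFreeGroup.Generators G), ∃ n : ℤ, g ^ n = x := by
    rcases isEmpty_or_nonempty (IsFreeGroup.Generators G) with _ | ⟨⟨i⟩⟩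
    · exact ⟨1, fun x => ⟨0, Subsingleton.elim _ _⟩⟩
    · have : Unique (IsFreeGroup.Generators G) := ⟨⟨i⟩, fun j => Subsingleton.elim j i⟩
      obtain ⟨g, hg⟩ := IsCyclic.exists_generator (α := FreeGroup (IsFreeGroup.Generators G))
      exact ⟨g, hg⟩
  obtain ⟨g, hg⟩ := hc
  refine ⟨e.symm g, fun x => ?_⟩
  obtain ⟨n, hn⟩ := hg (e x)
  exact ⟨n, by rw [← map_zpow, hn, e.symm_apply_apply]⟩

/-- By Nielsen–Schreier, x and [u,v] generate a free group. Being commutative it is cyclic, and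
[u,v], not being a proper power, is a generator of it up to inversion. -/
theorem mem_zpowers_of_commute {x : F2} (h : x * comm u v = comm u v * x) :
    x ∈ Subgroup.zpowers (comm u v) := by
  let H := Subgroup.closure {x, comm u v}
  have hcomm : ∀ a b : H, a * b = b * a :=
    (Subgroup.isMulCommutative_closure (k := {x, comm u v}) (by
      rintro _ (rfl | rfl) _ (rfl | rfl) <;> simp [h])).is_comm.comm
  obtain ⟨g, hg⟩ := IsFreeGroup.exists_zpow_of_commute H hcomm
  obtain ⟨m, hm⟩ := hg ⟨x, Subgroup.subset_closure (by simp)⟩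
  obtain ⟨n, hn⟩ := hg ⟨comm u v, Subgroup.subset_closure (by simp)⟩
  have hm' : (g : F2) ^ m = x := congrArg Subtype.val hm
  have hn' : (g : F2) ^ n = comm u v := congrArg Subtype.val hn
  obtain ⟨k, hk⟩ := isUnit_of_zpow_eq_comm hn'
  have hkk : n * n = 1 := by
    rcases Int.units_eq_one_or k with rfl | rfl <;> simp [← hk]
  refine ⟨n * m, ?_⟩
  change comm u v ^ (n * m) = x
  rw [← hn', ← zpow_mul, ← mul_assoc, hkk, one_mul, hm']

theorem inner_mem_Y {x : F2} (h : x * comm u v * x⁻¹ = comm u v ∨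
    x * comm u v * x⁻¹ = (comm u v)⁻¹) : inner x ∈ Y := by
  rcases h with h | h
  · obtain ⟨n, rfl⟩ := mem_zpowers_of_commute (mul_inv_eq_iff_eq_mul.mp h)
    exact ⟨n, (map_zpow (MulAut.conj : F2 →* MulAut F2) _ n).symm⟩
  · exact absurd h (conj_comm_ne_inv x)

theorem Int_inf_Φ_range_le : Int ⊓ Φ.range ≤ Y := by
  rintro _ ⟨⟨x, rfl⟩, hx⟩
  exact inner_mem_Y (apply_comm_of_mem hx)

/-! The structure of `Aut(F₂)`. -/

theorem mem_nielsenSubgroup (f : MulAut F2) : f ∈ nielsenSubgroup := by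
  obtain ⟨n, hn, h⟩ := exists_mem_nielsenSubgroup (f := f.toMonoidHom) (Or.inl f.surjective)
  have : n = f := MulEquiv.ext fun x => DFunLike.congr_fun h x
  exact this ▸ hn

theorem Int_eq_ker : Int = ρ.ker := by
  refine le_antisymm Int_le_ker fun f hf => ?_
  rw [← QuotientGroup.eq_one_iff]
  exact eq_one_of_ρOut_eq_one (mk_mem_closure (mem_nielsenSubgroup f)) hf

theorem bijective_of_surjective (f : F2 →* F2) (hf : Function.Surjective f) :
    Function.Bijective f := by
  obtain ⟨n, -, rfl⟩ := exists_mem_nielsenSubgroup (Or.inl hf)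
  exact n.bijective

theorem bijective_iff (f : F2 →* F2) : Function.Bijective f ↔ IsConjComm (comm (f u) (f v)) := by
  rw [← map_comm]
  constructor
  · intro hf
    obtain ⟨n, hn, rfl⟩ := exists_mem_nielsenSubgroup (Or.inl hf.2)
    exact isConjComm_apply_of_mem hn
  · intro hf
    obtain ⟨n, -, rfl⟩ := exists_mem_nielsenSubgroup (Or.inr hf)
    exact n.bijective

theorem exists_mem_Φ_range_iff (f : F2 →* F2) :
    (∃ g ∈ Φ.range, MulEquiv.toMonoidHom g = f) ↔
      comm (f u) (f v) = comm u v ∨ comm (f u) (f v) = (comm u v)⁻¹ := by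
  rw [← map_comm]
  constructor
  · rintro ⟨g, hg, rfl⟩
    exact apply_comm_of_mem hg
  · intro h
    obtain ⟨n, hn, rfl⟩ := exists_mem_nielsenSubgroup (f := f)
      (Or.inr ⟨1, by simpa using h⟩)
    refine ⟨n, ?_, rfl⟩
    obtain ⟨w, g, hg, rfl⟩ := mem_nielsenSubgroup_iff.mp hn
    -- Both f and g preserve [u,v] up to inversion, so conjugation by w does too. This places the
    -- inner factor in Y.
    refine mul_mem (Y_le_Φ (inner_mem_Y ?_)) hg
    change w * g (comm u v) * w⁻¹ = _ ∨ w * g (comm u v) * w⁻¹ = _ at h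
    rcases apply_comm_of_mem hg with hc | hc <;> rw [hc] at h
    · exact h
    · rw [← conj_inv, inv_inj, inv_eq_iff_eq_inv] at h
      exact h.symm

/-! ### The isomorphism with the amalgamated semidirect product. -/

/-- The morphism `(k, l) ↦ k l` from the semidirect product. -/
def semidirectHom : Int ⋊[nielsenDatum.ψ] Φ.range →* MulAut F2 :=
  SemidirectProduct.lift Int.subtype Φ.range.subtype fun l => by
    ext k
    rfl

/-- A pair in the kernel has l = k⁻¹, an element of Int(F₂) ∩ Φ(DB₃), hence of Y by
`Int_inf_Φ_range_le`. -/
theorem μ_range_eq_ker : nielsenDatum.μ.range = semidirectHom.ker := by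
  ext ⟨k, l⟩
  have hkl : (⟨k, l⟩ : Int ⋊[nielsenDatum.ψ] Φ.range) ∈ semidirectHom.ker ↔
      (k : MulAut F2) * l = 1 := Iff.rfl
  rw [hkl]
  constructor
  · rintro ⟨m, hm⟩
    have h1 := congrArg (fun p => (p.left : MulAut F2) * p.right) hm
    rw [← h1]
    exact inv_mul_cancel (m : MulAut F2)
  · intro h
    have hl : (l : MulAut F2) = (k : MulAut F2)⁻¹ := (inv_eq_of_mul_eq_one_right h).symm
    refine ⟨⟨l, Int_inf_Φ_range_le ⟨hl ▸ Int.inv_mem k.2, l.2⟩⟩, ?_⟩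
    apply SemidirectProduct.ext
    · apply Subtype.ext
      change (l : MulAut F2)⁻¹ = k
      rw [hl, inv_inv]
    · rfl

theorem semidirectHom_surjective : Function.Surjective semidirectHom := by
  intro f
  obtain ⟨w, g, hg, rfl⟩ := mem_nielsenSubgroup_iff.mp (mem_nielsenSubgroup f)
  exact ⟨⟨⟨inner w, w, rfl⟩, g, hg⟩, rfl⟩

/-- `Aut(F₂)` is the amalgamated semidirect product of `Int(F₂)` and `Φ(DB₃)`. -/
noncomputable def productEquiv : nielsenDatum.Product ≃* MulAut F2 :=
  (QuotientGroup.quotientMulEquivOfEq μ_range_eq_ker).trans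
    (QuotientGroup.quotientKerEquivOfSurjective semidirectHom semidirectHom_surjective)

end NielsenF2

theorem mainTheorem8 :
    -- i) surjective endomorphisms are automorphisms
    (∀ f : NielsenF2.F2 →* NielsenF2.F2, Function.Surjective f → Function.Bijective f) ∧
    -- ii) `Aut(F₂)` is the amalgamated semidirect product, through `(k, l) ↦ k l`
    (NielsenF2.inner (NielsenF2.comm NielsenF2.u NielsenF2.v) = NielsenF2.Φ NielsenF2.s4 ∧
      ∃ e : NielsenF2.nielsenDatum.Product ≃* MulAut NielsenF2.F2,
        ∀ (k : NielsenF2.Int) (l : NielsenF2.Φ.range),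
          e (NielsenF2.nielsenDatum.toProduct k l) =
            (k : MulAut NielsenF2.F2) * (l : MulAut NielsenF2.F2)) ∧
    -- iii) `Int(F₂)` is the kernel of `ρ : Aut(F₂) → GL(2, ℤ)`
    NielsenF2.Int = NielsenF2.ρ.ker ∧
    -- iv) characterization of automorphisms, and of the elements of `Φ(DB₃)`
    (∀ f : NielsenF2.F2 →* NielsenF2.F2,
      (Function.Bijective f ↔
        ∃ w : NielsenF2.F2,
          NielsenF2.comm (f NielsenF2.u) (f NielsenF2.v) =
              w⁻¹ * NielsenF2.comm NielsenF2.u NielsenF2.v * w ∨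
            NielsenF2.comm (f NielsenF2.u) (f NielsenF2.v) =
              w⁻¹ * (NielsenF2.comm NielsenF2.u NielsenF2.v)⁻¹ * w) ∧
      ((∃ g ∈ NielsenF2.Φ.range, MulEquiv.toMonoidHom g = f) ↔
        NielsenF2.comm (f NielsenF2.u) (f NielsenF2.v) =
            NielsenF2.comm NielsenF2.u NielsenF2.v ∨
          NielsenF2.comm (f NielsenF2.u) (f NielsenF2.v) =
            (NielsenF2.comm NielsenF2.u NielsenF2.v)⁻¹)) := by
  refine ⟨NielsenF2.bijective_of_surjective, ⟨NielsenF2.inner_eq_Φ_s4, ?_⟩,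
    NielsenF2.Int_eq_ker, fun f =>
      ⟨NielsenF2.bijective_iff f, NielsenF2.exists_mem_Φ_range_iff f⟩⟩
  exact ⟨NielsenF2.productEquiv, fun k l => rfl⟩
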